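/- Let $M$ be a smooth manifold with a normal almost contact metric structure $(g,\xi,\eta,\varphi)$: $g$ is a Riemannian metric, $\xi$ a unit vector field, $\eta=g(\xi,\cdot)$, and $\varphi$ an endomorphism of $TM$ with $\varphi(\xi)=0$, $\varphi^2=-1+\eta\otimes\xi$, $g(\varphi X,\varphi Y)=g(X,Y)-\eta(X)\eta(Y)$, such that $$[\varphi X,\varphi Y]+\varphi^2[X,Y]-\varphi[\varphi X,Y]-\varphi[X,\varphi Y]+d\eta(X,Y)\,\xi=0$$ for all vector fields $X,Y$, where $d\eta(X,Y)=X(\eta(Y))-Y(\eta(X))-\eta([X,Y])$. Let $\sigma_1,\sigma_2$ be closed, $\varphi$-invariant $2$-forms on $M$ (that is, $\sigma_i(\varphi\cdot,\varphi\cdot)=\sigma_i$), and let $\pi:\hat M\to M$ be a principal $S^1\times S^1$-bundle whose Chern classes are represented by $\sigma_1,\sigma_2$ (in particular, $\sigma_1,\sigma_2$ are integral); that is, for some connection form $(\omega_1',\omega_2')$ one has $\frac1{2\pi}d\omega_i'=\pi^*\tau_i$ with $\tau_i$ cohomologous to $\sigma_i$. Then there are connection forms $\omega=(\omega_1,\omega_2)$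 on $\hat M$ with $\frac1{2\pi}d\omega_i=\pi^*\sigma_i$. For every such $\omega$ and all real constants $s,t$ with $s^2+t^2=1$, an ST structure on $\hat M$, i.e. a normal almost contact metric structure $(\hat g,\hat\xi,\hat\eta,\hat\varphi)$ whose Reeb field $\hat\xi$ is Killing, is given by $$\hat g(X,Y)=\omega_1(X)\omega_1(Y)+\omega_2(X)\omega_2(Y)+g(\pi_*X,\pi_*Y),$$ $$\hat\xi=tX_1+sX_2,\qquad \hat\eta=t\omega_1+s\omega_2,\qquad \hat\varphi=\varphi+\hat\eta^\perp\otimes\xi-\eta\otimes\hat\xi^\perp,$$ where $X_1,X_2$ are the fundamental vector fields of the two circle factors (of period $2\pi$), so that $\omega_i(X_j)=\delta_{ij}$, where $\hat\xi^\perp=-sX_1+tX_2$ and $\hat\eta^\perp=-s\omega_1+t\omega_2$, and where tensors on $M$ are lifted to $\hat M$ horizontally, i.e. to $\ker\omega_1\cap\ker\omega_2$; explicitly $\hat\varphi(v)=(\varphi(\pi_*v))^{h}+\hat\eta^\perp(v)\,\xi^{h}-\eta(\pi_*v)\,\hat\xi^\perp$, with $u^h$ the horizontal lift of $u$. -/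

import Mathlib

open scoped Manifold ContDiff

noncomputable section

namespace TorusBundleST

/-! ## Tensor fields on a real manifold -/

section Tensors

variable {E : Type*} [NormedAddCommGroup E] [NormedSpace ℝ E]
  {H : Type*} [TopologicalSpace H] (I : ModelWithCorners ℝ E H)
  (M : Type*) [TopologicalSpace M] [ChartedSpace H M]

/-- Vector fields (not necessarily smooth). -/
abbrev VField : Type _ := ∀ x : M, TangentSpace I x

/-- Fields of linear forms (not necessarily smooth). -/
abbrev OneTensor : Type _ := ∀ x : M, TangentSpace I x →L[ℝ] ℝ

/-- Fields of bilinear forms (not necessarily smooth). -/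
abbrev TwoTensor : Type _ := ∀ x : M, TangentSpace I x →L[ℝ] TangentSpace I x →L[ℝ] ℝ

/-- Fields of endomorphisms of the tangent bundle (not necessarily smooth). -/
abbrev EndTensor : Type _ := ∀ x : M, TangentSpace I x →L[ℝ] TangentSpace I x

variable {I M}

variable [IsManifold I ∞ M]

/-- `X` is a smooth vector field. -/
def SmoothField (X : VField I M) : Prop :=
  ContMDiff I I.tangent ∞ (fun x => (⟨x, X x⟩ : TangentBundle I M))

/-- `α` is a smooth `1`-form: a smooth section of the bundle `Hom(TM, ℝ)`. -/
def SmoothOneForm (α : OneTensor I M) : Prop :=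
  ContMDiff I (I.prod 𝓘(ℝ, E →L[ℝ] ℝ)) ∞
    (fun x => Bundle.TotalSpace.mk' (E →L[ℝ] ℝ)
      (E := fun x : M => TangentSpace I x →L[ℝ] Bundle.Trivial M ℝ x) x (α x))

/-- `σ` is a smooth `2`-form: alternating, and a smooth section of `Hom(TM, Hom(TM, ℝ))`. -/
structure SmoothTwoForm (σ : TwoTensor I M) : Prop where
  alternating : ∀ (x : M) (v : TangentSpace I x), σ x v v = 0
  smooth : ContMDiff I (I.prod 𝓘(ℝ, E →L[ℝ] E →L[ℝ] ℝ)) ∞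
    (fun x => Bundle.TotalSpace.mk' (E →L[ℝ] E →L[ℝ] ℝ)
      (E := fun x : M => TangentSpace I x →L[ℝ] TangentSpace I x →L[ℝ] Bundle.Trivial M ℝ x)
      x (σ x))

/-- `φ` is a smooth endomorphism of `TM`: a smooth section of `Hom(TM, TM)`. -/
def SmoothEnd (φ : EndTensor I M) : Prop :=
  ContMDiff I (I.prod 𝓘(ℝ, E →L[ℝ] E)) ∞
    (fun x => Bundle.TotalSpace.mk' (E →L[ℝ] E)
      (E := fun x : M => TangentSpace I x →L[ℝ] TangentSpace I x) x (φ x))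

/-- The derivative `X f` of the real function `f` along the vector field `X`. -/
def dirDeriv (X : VField I M) (f : M → ℝ) (x : M) : ℝ :=
  mfderiv I 𝓘(ℝ, ℝ) f x (X x)

/-- The exterior derivative of a `1`-form, evaluated on two vector fields:
`dα(X, Y) = X(α(Y)) - Y(α(X)) - α([X, Y])`. -/
def dOne (α : OneTensor I M) (X Y : VField I M) (x : M) : ℝ :=
  dirDeriv X (fun y => α y (Y y)) x - dirDeriv Y (fun y => α y (X y)) x
    - α x (VectorField.mlieBracket I X Y x)

/-- The exterior derivative of a `2`-form, evaluated on three vector fields. -/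
def dTwo (σ : TwoTensor I M) (X Y Z : VField I M) (x : M) : ℝ :=
  dirDeriv X (fun y => σ y (Y y) (Z y)) x
    + dirDeriv Y (fun y => σ y (Z y) (X y)) x
    + dirDeriv Z (fun y => σ y (X y) (Y y)) x
    - σ x (VectorField.mlieBracket I X Y x) (Z x)
    - σ x (VectorField.mlieBracket I Y Z x) (X x)
    - σ x (VectorField.mlieBracket I Z X x) (Y x)

/-- `dσ = 0`. -/
def ClosedTwoForm (σ : TwoTensor I M) : Prop :=
  ∀ X Y Z : VField I M, SmoothField X → SmoothField Y → SmoothField Z →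
    ∀ x : M, dTwo σ X Y Z x = 0

/-- The `2`-forms `σ` and `τ` differ by `dα` for a smooth `1`-form `α`, that is, closed forms
`σ`, `τ` have the same de Rham class. -/
def Cohomologous (σ τ : TwoTensor I M) : Prop :=
  ∃ α : OneTensor I M, SmoothOneForm α ∧
    ∀ X Y : VField I M, SmoothField X → SmoothField Y →
      ∀ x : M, σ x (X x) (Y x) - τ x (X x) (Y x) = dOne α X Y x

end Tensors

/-! ## Almost contact metric structures and ST structures -/

section Contact

variable {E : Type*} [NormedAddCommGroup E] [NormedSpace ℝ E]
  {H : Type*} [TopologicalSpace H] (I : ModelWithCorners ℝ E H)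
  (M : Type*) [TopologicalSpace M] [ChartedSpace H M] [IsManifold I ∞ M]

/-- An almost contact metric structure `(g, ξ, η, φ)`. The `1`-form `η` is the metric dual of `ξ`
and is therefore not a separate field, see `AlmostContactMetric.η`. -/
structure AlmostContactMetric where
  /-- The smooth Riemannian metric. -/
  g : Bundle.ContMDiffRiemannianMetric I ∞ E (fun x : M => TangentSpace I x)
  /-- The Reeb vector field. -/
  ξ : VField I M
  /-- The endomorphism of the tangent bundle. -/
  φ : EndTensor I M
  smooth_ξ : SmoothField ξ
  smooth_φ : SmoothEnd φ
  unit_ξ : ∀ x, g.inner x (ξ x) (ξ x) = 1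
  φ_ξ : ∀ x, φ x (ξ x) = 0
  φ_φ : ∀ (x : M) (v : TangentSpace I x), φ x (φ x v) = -v + g.inner x (ξ x) v • ξ x
  g_φ_φ : ∀ (x : M) (v w : TangentSpace I x),
    g.inner x (φ x v) (φ x w) = g.inner x v w - g.inner x (ξ x) v * g.inner x (ξ x) w

variable {I M}

namespace AlmostContactMetric

variable (S : AlmostContactMetric I M)

/-- The dual `1`-form `η = g(ξ, ·)`. -/
def η : OneTensor I M := fun x => S.g.inner x (S.ξ x)

/-- The vector field `φ(X)`. -/
def applyφ (X : VField I M) : VField I M := fun x => S.φ x (X x)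

/-- The Sasaki-Hatakeyama tensor
`S(X, Y) = [φX, φY] + φ²[X, Y] - φ[φX, Y] - φ[X, φY] + dη(X, Y) ξ`. -/
def sasakiHatakeyama (X Y : VField I M) : VField I M := fun x =>
  VectorField.mlieBracket I (S.applyφ X) (S.applyφ Y) x
    + S.φ x (S.φ x (VectorField.mlieBracket I X Y x))
    - S.φ x (VectorField.mlieBracket I (S.applyφ X) Y x)
    - S.φ x (VectorField.mlieBracket I X (S.applyφ Y) x)
    + dOne S.η X Y x • S.ξ x

/-- The structure is normal if its Sasaki-Hatakeyama tensor vanishes. -/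
def IsNormal : Prop :=
  ∀ X Y : VField I M, SmoothField X → SmoothField Y → ∀ x : M, S.sasakiHatakeyama X Y x = 0

/-- `ξ` is a Killing field: `(L_ξ g)(X, Y) = ξ(g(X, Y)) - g([ξ, X], Y) - g(X, [ξ, Y]) = 0`. -/
def IsKilling : Prop :=
  ∀ X Y : VField I M, SmoothField X → SmoothField Y → ∀ x : M,
    dirDeriv S.ξ (fun y => S.g.inner y (X y) (Y y)) x
      - S.g.inner x (VectorField.mlieBracket I S.ξ X x) (Y x)
      - S.g.inner x (X x) (VectorField.mlieBracket I S.ξ Y x) = 0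

/-- A Sasaki with torsion (ST) structure: a normal almost contact metric structure whose Reeb
vector field is Killing. -/
structure IsST : Prop where
  normal : S.IsNormal
  killing : S.IsKilling

/-- The bilinear form `σ` is `φ`-invariant: `σ(φ·, φ·) = σ`. -/
def Invariant (σ : TwoTensor I M) : Prop :=
  ∀ (x : M) (v w : TangentSpace I x), σ x (S.φ x v) (S.φ x w) = σ x v w

end AlmostContactMetric

end Contact

/-! ## Principal torus bundles -/

/-- The torus `S¹ × S¹` as a Lie group. -/
abbrev Torus : Type := Circle × Circle

/-- The model of the torus as a manifold. -/
abbrev torusModel := (𝓡 1).prod (𝓡 1)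

section Bundle

variable {E : Type*} [NormedAddCommGroup E] [NormedSpace ℝ E]
  {H : Type*} [TopologicalSpace H] (I : ModelWithCorners ℝ E H)
  {M : Type*} [TopologicalSpace M] [ChartedSpace H M]
  {E' : Type*} [NormedAddCommGroup E'] [NormedSpace ℝ E']
  {H' : Type*} [TopologicalSpace H'] (I' : ModelWithCorners ℝ E' H')
  {P : Type*} [TopologicalSpace P] [ChartedSpace H' P] [MulAction Torus P]

/-- `π : P → M` is a smooth principal torus bundle: the torus acts smoothly on `P` along the fibres
of `π`, and over an open neighbourhood of each point of `M` there is a smooth equivariant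
trivialization. (The torus is commutative, so left and right actions are the same.) -/
structure IsPrincipalTorusBundle (π : P → M) : Prop where
  smooth_proj : ContMDiff I' I ∞ π
  smooth_act : ContMDiff (torusModel.prod I') I' ∞ (fun q : Torus × P => q.1 • q.2)
  proj_act : ∀ (a : Torus) (p : P), π (a • p) = π p
  locally_trivial : ∀ x : M, ∃ e : Bundle.Trivialization Torus π, x ∈ e.baseSet ∧
    ContMDiffOn I' (I.prod torusModel) ∞ e e.source ∧
    ContMDiffOn (I.prod torusModel) I' ∞ e.toOpenPartialHomeomorph.symm e.target ∧
    ∀ (a : Torus), ∀ p ∈ e.source, (e (a • p)).2 = a * (e p).2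

/-- The fundamental vector field of the element `(a, b)` of the Lie algebra `ℝ²` of the torus: its
value at `p` is the velocity at time `0` of the curve `t ↦ (exp(iat), exp(ibt)) • p`. -/
def fundamentalField (a b : ℝ) : VField I' P := fun p =>
  (mfderiv 𝓘(ℝ, ℝ) I' (fun t : ℝ => ((Circle.exp (a * t), Circle.exp (b * t)) : Torus) • p) 0
    (1 : ℝ) : E')

/-- The fundamental vector field `X₁` of the first circle factor (of period `2π`). -/
def fundX₁ : VField I' P := fundamentalField I' 1 0

/-- The fundamental vector field `X₂` of the second circle factor (of period `2π`). -/
def fundX₂ : VField I' P := fundamentalField I' 0 1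

variable {I'}

/-- `ω = (ω₁, ω₂)` is a connection form: smooth, reproducing the generators of the fundamental
vector fields, and invariant under the torus. -/
structure IsConnection [IsManifold I' ∞ P] (ω₁ ω₂ : OneTensor I' P) : Prop where
  smooth₁ : SmoothOneForm ω₁
  smooth₂ : SmoothOneForm ω₂
  fund₁₁ : ∀ p, ω₁ p (fundX₁ I' p) = 1
  fund₁₂ : ∀ p, ω₁ p (fundX₂ I' p) = 0
  fund₂₁ : ∀ p, ω₂ p (fundX₁ I' p) = 0
  fund₂₂ : ∀ p, ω₂ p (fundX₂ I' p) = 1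
  invariant₁ : ∀ (a : Torus) (p : P) (v : TangentSpace I' p),
    ω₁ (a • p) (mfderiv I' I' (fun q : P => a • q) p v) = ω₁ p v
  invariant₂ : ∀ (a : Torus) (p : P) (v : TangentSpace I' p),
    ω₂ (a • p) (mfderiv I' I' (fun q : P => a • q) p v) = ω₂ p v

variable {I}

/-- The `1`-form `η` on the total space satisfies `(1 / 2π) dη = π^* σ`. -/
def HasCurvature [IsManifold I' ∞ P] (π : P → M) (η : OneTensor I' P) (σ : TwoTensor I M) : Prop :=
  ∀ X Y : VField I' P, SmoothField X → SmoothField Y → ∀ p : P,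
    1 / (2 * Real.pi) * dOne η X Y p
      = σ (π p) (mfderiv I' I π p (X p)) (mfderiv I' I π p (Y p))

/-- The closed forms `σ₁`, `σ₂` represent the Chern classes of the principal torus bundle `π`
(Chern-Weil): they are cohomologous to the normalized curvature forms of some connection. -/
def HasChernClasses [IsManifold I ∞ M] [IsManifold I' ∞ P] (π : P → M)
    (σ₁ σ₂ : TwoTensor I M) : Prop :=
  ∃ (ω₁ ω₂ : OneTensor I' P) (τ₁ τ₂ : TwoTensor I M),
    IsConnection ω₁ ω₂ ∧ SmoothTwoForm τ₁ ∧ SmoothTwoForm τ₂ ∧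
    HasCurvature π ω₁ τ₁ ∧ HasCurvature π ω₂ τ₂ ∧
    Cohomologous σ₁ τ₁ ∧ Cohomologous σ₂ τ₂

open Classical in
/-- The horizontal lift to `p` of a tangent vector `u` at `π p`: the vector `w` at `p` which
projects to `u` and satisfies `ω₁(w) = ω₂(w) = 0`. (It exists and is unique for a connection form
on a principal torus bundle; the value `0` is never used.) -/
def horizontalLift (π : P → M) (ω₁ ω₂ : OneTensor I' P) (p : P) (u : TangentSpace I (π p)) :
    TangentSpace I' p :=
  if h : ∃ w : TangentSpace I' p, mfderiv I' I π p w = u ∧ ω₁ p w = 0 ∧ ω₂ p w = 0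
  then h.choose else 0

end Bundle

end TorusBundleST

end

/-!
A connection identifies each tangent space of the bundle with a tangent space of `M` times `ℝ²`. The
Sasaki–Hatakeyama tensor and the Lie derivative of the metric along the Reeb field are tensorial, so
it is enough to evaluate them on lifts of vector fields of `M` with constant vertical coordinates.
The bracket of the lifts of `U` and `V` projects to `[U, V]` and has vertical coordinates
`-2π σᵢ(U, V)`. In the Sasaki–Hatakeyama tensor of the bundle these curvature terms cancel because
`σᵢ` is `φ`-invariant (in particular `σᵢ(ξ, ·) = 0`), and the remaining terms cancel because `M` is
normal. The vertical fields commute with the lifts, so the Reeb field is Killing.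

Rotating `(ω₁, ω₂)` by `(s, t)` gives another such splitting, whose curvature forms are the rotated
`σᵢ`; this reduces the theorem to the case where the Reeb field is dual to the first of the two
forms. For the existence of `ω`, adding `2π π^*θ` to a connection form adds `dθ` to its normalized
curvature.
-/

namespace TorusBundleST

/-! ### Vector fields and Lie brackets -/

section Calculus

variable {E : Type*} [NormedAddCommGroup E] [NormedSpace ℝ E]
  {H : Type*} [TopologicalSpace H] {I : ModelWithCorners ℝ E H}
  {M : Type*} [TopologicalSpace M] [ChartedSpace H M]
  {F : Type*} [NormedAddCommGroup F] [NormedSpace ℝ F]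

lemma mvfderiv_congr {f g : M → F} {x : M} (h : f =ᶠ[nhds x] g) :
    mvfderiv I f x = mvfderiv I g x :=
  h.mfderiv_eq (I := I) (I' := 𝓘(ℝ, F))

variable (I) in
/-- The vector field `X` in the chart at `x`, as a vector field on the model space. -/
noncomputable def chartField (x : M) (X : VField I M) : E → E :=
  VectorField.mpullbackWithin 𝓘(ℝ, E) I (extChartAt I x).symm X (Set.range I)

section

variable [I.Boundaryless]

lemma fderiv_comp_extChartAt_symm_chartField [IsManifold I 1 M] {f : M → F} {x : M} {z : E}
    (hz : z ∈ (extChartAt I x).target)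
    (hf : MDifferentiableAt I 𝓘(ℝ, F) f ((extChartAt I x).symm z)) (X : VField I M) :
    fderiv ℝ (f ∘ (extChartAt I x).symm) z (chartField I x X z)
      = mvfderiv I f ((extChartAt I x).symm z) (X ((extChartAt I x).symm z)) := by
  have hinv := (isInvertible_mfderivWithin_extChartAt_symm (I := I) hz).self_apply_inverse
    (X ((extChartAt I x).symm z))
  have hsymm := mdifferentiableWithinAt_extChartAt_symm (I := I) hz
  rw [chartField, VectorField.mpullbackWithin_apply]
  rw [I.range_eq_univ, mdifferentiableWithinAt_univ] at hsymm
  rw [I.range_eq_univ, mfderivWithin_univ] at hinv ⊢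
  rw [← mfderiv_eq_fderiv, mfderiv_comp z hf hsymm]
  exact congrArg (mvfderiv I f ((extChartAt I x).symm z)) hinv

variable [IsManifold I ∞ M]

lemma differentiableAt_chartField [CompleteSpace E] {X : VField I M} (hX : SmoothField X)
    (x : M) : DifferentiableAt ℝ (chartField I x X) (extChartAt I x x) := by
  have h := ((hX x).mdifferentiableAt (by simp)).mdifferentiableWithinAt (s := Set.univ)
    |>.differentiableWithinAt_mpullbackWithin_vectorField
  have hset : (extChartAt I x).symm ⁻¹' Set.univ ∩ Set.range I = Set.univ := by
    rw [Set.preimage_univ, Set.univ_inter, I.range_eq_univ]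
  rw [hset] at h
  exact differentiableWithinAt_univ.1 h

lemma mvfderiv_mlieBracket_eq_fderiv_lieBracket {f : M → F} {x : M}
    (hf : MDifferentiableAt I 𝓘(ℝ, F) f x) (X Y : VField I M) :
    mvfderiv I f x (VectorField.mlieBracket I X Y x)
      = fderiv ℝ (f ∘ (extChartAt I x).symm) (extChartAt I x x)
          (VectorField.lieBracket ℝ (chartField I x X) (chartField I x Y) (extChartAt I x x)) := by
  have hset : (extChartAt I x).symm ⁻¹' Set.univ ∩ Set.range I = Set.univ := by
    rw [Set.preimage_univ, Set.univ_inter, I.range_eq_univ]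
  rw [hf.mvfderiv, ← VectorField.mlieBracketWithin_univ, VectorField.mlieBracketWithin_apply,
    mfderiv_extChartAt_self, hset]
  change fderivWithin ℝ (f ∘ (extChartAt I x).symm) (Set.range I) _
    ((ContinuousLinearMap.id ℝ E).inverse (VectorField.lieBracketWithin ℝ
      (chartField I x X) (chartField I x Y) Set.univ _)) = _
  rw [ContinuousLinearMap.inverse_id, VectorField.lieBracketWithin_univ, I.range_eq_univ,
    fderivWithin_univ]
  rfl

lemma eventuallyEq_fderiv_chartField {f : M → F} {x : M} (hf : ContMDiffAt I 𝓘(ℝ, F) ∞ f x)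
    (X : VField I M) :
    (fun z => fderiv ℝ (f ∘ (extChartAt I x).symm) z (chartField I x X z))
      =ᶠ[nhds (extChartAt I x x)] (fun y => mvfderiv I f y (X y)) ∘ (extChartAt I x).symm := by
  have hsymm : Filter.Tendsto (extChartAt I x).symm (nhds (extChartAt I x x)) (nhds x) := by
    simpa only [ContinuousAt, extChartAt_to_inv] using continuousAt_extChartAt_symm (I := I) x
  have hdiff : ∀ᶠ y in nhds x, MDifferentiableAt I 𝓘(ℝ, F) f y :=
    ((contMDiffAt_iff_contMDiffAt_nhds (n := 1) (by simp)).1 (hf.of_le (by norm_cast))).mono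
      fun y hy => hy.mdifferentiableAt one_ne_zero
  filter_upwards [hsymm.eventually hdiff, extChartAt_target_mem_nhds (I := I) x] with z hz hzt
  exact fderiv_comp_extChartAt_symm_chartField hzt hz X

end

variable [IsManifold I ∞ M]

lemma contMDiffAt_mvfderiv_apply {f : M → F} {x : M} (hf : ContMDiffAt I 𝓘(ℝ, F) ∞ f x)
    {X : VField I M} (hX : SmoothField X) :
    ContMDiffAt I 𝓘(ℝ, F) ∞ (fun y => mvfderiv I f y (X y)) x := by
  have h := (hf.mfderiv_const (m := ∞) (by simp)).clm_apply_of_inCoordinates (b₁ := id)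
    (hX x) hf
  exact (contMDiff_snd_tangentBundle_modelSpace F 𝓘(ℝ, F)).contMDiffAt.comp x h

lemma mvfderiv_mlieBracket [I.Boundaryless] [CompleteSpace E]
    {f : M → F} {x : M} (hf : ContMDiffAt I 𝓘(ℝ, F) ∞ f x) {X Y : VField I M}
    (hX : SmoothField X) (hY : SmoothField Y) :
    mvfderiv I f x (VectorField.mlieBracket I X Y x)
      = mvfderiv I (fun y => mvfderiv I f y (Y y)) x (X x)
        - mvfderiv I (fun y => mvfderiv I f y (X y)) x (Y x) := by
  have hchart : ContDiffAt ℝ ∞ (f ∘ (extChartAt I x).symm) (extChartAt I x x) := by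
    have := (contMDiffAt_iff.1 hf).2
    rw [I.range_eq_univ] at this
    exact this.contDiffAt Filter.univ_mem
  have hbase {h : M → F} (hh : ContMDiffAt I 𝓘(ℝ, F) ∞ h x) (Z : VField I M) :
      fderiv ℝ (h ∘ (extChartAt I x).symm) (extChartAt I x x)
        (chartField I x Z (extChartAt I x x)) = mvfderiv I h x (Z x) := by
    rw [(eventuallyEq_fderiv_chartField hh Z).eq_of_nhds, Function.comp_apply, extChartAt_to_inv]
  rw [mvfderiv_mlieBracket_eq_fderiv_lieBracket (hf.mdifferentiableAt (by simp)),
    VectorField.fderiv_apply_lieBracket hchart (by simp; norm_cast)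
      (differentiableAt_chartField hY x) (differentiableAt_chartField hX x),
    (eventuallyEq_fderiv_chartField hf X).fderiv_eq,
    (eventuallyEq_fderiv_chartField hf Y).fderiv_eq,
    hbase (contMDiffAt_mvfderiv_apply hf hY), hbase (contMDiffAt_mvfderiv_apply hf hX)]

end Calculus

section Related

variable {E : Type*} [NormedAddCommGroup E] [NormedSpace ℝ E] [CompleteSpace E]
  {H : Type*} [TopologicalSpace H] {I : ModelWithCorners ℝ E H} [I.Boundaryless]
  {M : Type*} [TopologicalSpace M] [ChartedSpace H M] [IsManifold I ∞ M]
  {E' : Type*} [NormedAddCommGroup E'] [NormedSpace ℝ E'] [CompleteSpace E']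
  {H' : Type*} [TopologicalSpace H'] {I' : ModelWithCorners ℝ E' H'} [I'.Boundaryless]
  {P : Type*} [TopologicalSpace P] [ChartedSpace H' P] [IsManifold I' ∞ P]

lemma mfderiv_mlieBracket_of_related {π : P → M} (hπ : ContMDiff I' I ∞ π)
    {X Y : VField I' P} {U V : VField I M} (hX : SmoothField X) (hY : SmoothField Y)
    (hU : SmoothField U) (hV : SmoothField V) (hXU : ∀ q, mfderiv I' I π q (X q) = U (π q))
    (hYV : ∀ q, mfderiv I' I π q (Y q) = V (π q)) (p : P) :
    mfderiv I' I π p (VectorField.mlieBracket I' X Y p)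
      = VectorField.mlieBracket I U V (π p) := by
  set f := extChartAt I (π p)
  have hf : ContMDiffAt I 𝓘(ℝ, E) ∞ f (π p) := contMDiffAt_extChartAt
  have hderiv {h : M → E} {q : P} (hh : MDifferentiableAt I 𝓘(ℝ, E) h (π q))
      (v : TangentSpace I' q) :
      mvfderiv I' (h ∘ π) q v = mvfderiv I h (π q) (mfderiv I' I π q v) :=
    congrArg (· v) (mfderiv_comp q hh (hπ.mdifferentiable (by simp) q))
  have hfield {Z : VField I' P} {W : VField I M} (hZW : ∀ q, mfderiv I' I π q (Z q) = W (π q)) :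
      (fun q => mvfderiv I' (f ∘ π) q (Z q)) =ᶠ[nhds p] (fun y => mvfderiv I f y (W y)) ∘ π := by
    filter_upwards [hπ.continuous.continuousAt.eventually
      ((chartAt H (π p)).open_source.mem_nhds (mem_chart_source H (π p)))] with q hq
    rw [hderiv (mdifferentiableAt_extChartAt hq), hZW, Function.comp_apply]
  refine (isInvertible_mfderiv_extChartAt (mem_extChartAt_source (π p))).injective ?_
  change mvfderiv I f (π p) _ = mvfderiv I f (π p) _
  rw [← hderiv (hf.mdifferentiableAt (by simp)), mvfderiv_mlieBracket (hf.comp p (hπ p)) hX hY,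
    mvfderiv_mlieBracket hf hU hV, mvfderiv_congr (hfield hXU), mvfderiv_congr (hfield hYV),
    hderiv ((contMDiffAt_mvfderiv_apply hf hV).mdifferentiableAt (by simp)),
    hderiv ((contMDiffAt_mvfderiv_apply hf hU).mdifferentiableAt (by simp)), hXU, hYV]

end Related

/-! ### Smoothness of tensor fields -/

section Model

variable {E : Type*} [NormedAddCommGroup E] [NormedSpace ℝ E]
  {H : Type*} [TopologicalSpace H] {I : ModelWithCorners ℝ E H}
  {M : Type*} [TopologicalSpace M] [ChartedSpace H M] {x : M}
  {F : Type*} [NormedAddCommGroup F] [NormedSpace ℝ F]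
  {F' : Type*} [NormedAddCommGroup F'] [NormedSpace ℝ F']

lemma contMDiffAt_clm_of_apply [FiniteDimensional ℝ F] {A : M → F →L[ℝ] F'}
    (hA : ∀ v, ContMDiffAt I 𝓘(ℝ, F') ∞ (fun y => A y v) x) :
    ContMDiffAt I 𝓘(ℝ, F →L[ℝ] F') ∞ A x := by
  let basis := Module.finBasis ℝ F
  have hsum : A = fun y => ∑ i, ContinuousLinearMap.smulRightL ℝ F F'
      (basis.coord i).toContinuousLinearMap (A y (basis i)) := by
    ext y v
    conv_lhs => rw [← basis.sum_repr v, map_sum]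
    simp only [map_smul, sum_apply]
    rfl
  rw [hsum]
  exact ContMDiffAt.sum fun i _ => contMDiffAt_const.clm_apply (hA (basis i))

lemma contMDiffAt_of_clm_apply [CompleteSpace F] {A : M → F →L[ℝ] F'} {v : M → F}
    (hA : ContMDiffAt I 𝓘(ℝ, F →L[ℝ] F') ∞ A x) (hinv : (A x).IsInvertible)
    (hv : ContMDiffAt I 𝓘(ℝ, F') ∞ (fun y => A y (v y)) x) :
    ContMDiffAt I 𝓘(ℝ, F) ∞ v x := by
  obtain ⟨e, he⟩ := hinv
  have hinverse : ContMDiffAt I 𝓘(ℝ, F' →L[ℝ] F) ∞ (fun y => (A y).inverse) x := by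
    have : ContDiffAt ℝ ∞ ContinuousLinearMap.inverse (A x) := he ▸ contDiffAt_map_inverse e
    exact this.contMDiffAt.comp x hA
  refine (hinverse.clm_apply hv).congr_of_eventuallyEq ?_
  have hopen : Set.range ((↑) : (F ≃L[ℝ] F') → F →L[ℝ] F') ∈ nhds (A x) :=
    he ▸ ContinuousLinearEquiv.nhds e
  filter_upwards [hA.continuousAt.eventually hopen] with y ⟨ey, hey⟩
  rw [← hey, ContinuousLinearMap.inverse_equiv]
  exact (ey.symm_apply_apply (v y)).symm

end Model

section Sections

variable {E : Type*} [NormedAddCommGroup E] [NormedSpace ℝ E]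
  {H : Type*} [TopologicalSpace H] {I : ModelWithCorners ℝ E H}
  {M : Type*} [TopologicalSpace M] [ChartedSpace H M]
  {F : Type*} [NormedAddCommGroup F] [NormedSpace ℝ F]
  {V : M → Type*} [TopologicalSpace (Bundle.TotalSpace F V)]
  [∀ x, AddCommGroup (V x)] [∀ x, Module ℝ (V x)] [∀ x, TopologicalSpace (V x)]
  [FiberBundle F V] [VectorBundle ℝ F V] [ContMDiffVectorBundle ∞ F V I]
  {F' : Type*} [NormedAddCommGroup F'] [NormedSpace ℝ F']
  {V' : M → Type*} [TopologicalSpace (Bundle.TotalSpace F' V')]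
  [∀ x, AddCommGroup (V' x)] [∀ x, Module ℝ (V' x)] [∀ x, TopologicalSpace (V' x)]
  [∀ x, IsTopologicalAddGroup (V' x)] [∀ x, ContinuousSMul ℝ (V' x)]
  [FiberBundle F' V'] [VectorBundle ℝ F' V']

variable (I) in
lemma contMDiffOn_trivializationAt_symmL (x : M) (v : F) :
    ContMDiffOn I (I.prod 𝓘(ℝ, F)) ∞
      (fun y => Bundle.TotalSpace.mk' F y ((trivializationAt F V x).symmL ℝ y v))
      (trivializationAt F V x).baseSet := by
  rw [(trivializationAt F V x).contMDiffOn_section_baseSet_iff]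
  refine (contMDiffOn_const (c := v)).congr fun y hy => ?_
  rw [(trivializationAt F V x).symmL_apply hy, (trivializationAt F V x).apply_mk_symm hy]

variable [FiniteDimensional ℝ E] [T2Space M] [IsManifold I ∞ M]

variable (I V) in
lemma exists_contMDiff_section_eventuallyEq (x : M) (v : F) :
    ∃ s : ∀ y, V y, ContMDiff I (I.prod 𝓘(ℝ, F)) ∞ (fun y => Bundle.TotalSpace.mk' F y (s y)) ∧
      ∀ᶠ y in nhds x, s y = (trivializationAt F V x).symmL ℝ y v := by
  let e := trivializationAt F V x
  obtain ⟨f, -, hf⟩ := (SmoothBumpFunction.nhds_basis_tsupport (I := I) x).mem_iff.1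
    (e.open_baseSet.mem_nhds (FiberBundle.mem_baseSet_trivializationAt F V x))
  refine ⟨(f : M → ℝ) • fun y => e.symmL ℝ y v, ?_, ?_⟩
  · exact ContMDiffOn.smul_section_of_tsupport f.contMDiff.contMDiffOn e.open_baseSet hf
      (contMDiffOn_trivializationAt_symmL I x v)
  · filter_upwards [f.eventuallyEq_one] with y hy
    rw [Pi.smul_apply', hy, Pi.one_apply, one_smul]

lemma contMDiff_hom_of_apply [FiniteDimensional ℝ F] {L : ∀ x, V x →L[ℝ] V' x}
    (hL : ∀ s : ∀ x, V x,
      ContMDiff I (I.prod 𝓘(ℝ, F)) ∞ (fun x => Bundle.TotalSpace.mk' F x (s x)) →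
      ContMDiff I (I.prod 𝓘(ℝ, F')) ∞ (fun x => Bundle.TotalSpace.mk' F' x (L x (s x)))) :
    ContMDiff I (I.prod 𝓘(ℝ, F →L[ℝ] F')) ∞
      (fun x => Bundle.TotalSpace.mk' (F →L[ℝ] F') (E := fun x => V x →L[ℝ] V' x) x (L x)) := by
  intro x₀
  refine (contMDiffAt_hom_bundle _).2 ⟨contMDiffAt_id, ?_⟩
  refine contMDiffAt_clm_of_apply fun v => ?_
  obtain ⟨s, hs, hsv⟩ := exists_contMDiff_section_eventuallyEq I V x₀ v
  refine (Bundle.contMDiffAt_totalSpace.1 (hL s hs x₀)).2.congr_of_eventuallyEq ?_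
  have hbase : (trivializationAt F' V' x₀).baseSet ∈ nhds x₀ :=
    (trivializationAt F' V' x₀).open_baseSet.mem_nhds
      (FiberBundle.mem_baseSet_trivializationAt F' V' x₀)
  filter_upwards [hsv, hbase] with y hy hyb
  rw [hy, ContinuousLinearMap.inCoordinates, ContinuousLinearMap.comp_apply,
    ContinuousLinearMap.comp_apply,
    (trivializationAt F' V' x₀).continuousLinearMapAt_apply_of_mem ℝ hyb]

end Sections

section Fields

variable {E : Type*} [NormedAddCommGroup E] [NormedSpace ℝ E]
  {H : Type*} [TopologicalSpace H] {I : ModelWithCorners ℝ E H}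
  {M : Type*} [TopologicalSpace M] [ChartedSpace H M] [IsManifold I ∞ M]

lemma SmoothField.mdifferentiableAt {X : VField I M} (hX : SmoothField X) (x : M) :
    MDifferentiableAt I I.tangent (fun y => (⟨y, X y⟩ : TangentBundle I M)) x :=
  hX.mdifferentiable (by simp) x

lemma SmoothEnd.apply {φ : EndTensor I M} (hφ : SmoothEnd φ) {X : VField I M}
    (hX : SmoothField X) : SmoothField (fun x => φ x (X x)) :=
  fun x => (hφ x).clm_bundle_apply (hX x)

lemma SmoothOneForm.apply {α : OneTensor I M} (hα : SmoothOneForm α) {X : VField I M}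
    (hX : SmoothField X) : ContMDiff I 𝓘(ℝ, ℝ) ∞ (fun y => α y (X y)) :=
  fun x => (Bundle.contMDiffAt_section _).1 ((hα x).clm_bundle_apply (hX x))

variable [FiniteDimensional ℝ E] [T2Space M]

lemma exists_smoothField_apply_eq {x : M} (v : TangentSpace I x) :
    ∃ X : VField I M, SmoothField X ∧ X x = v := by
  let e := trivializationAt E (TangentSpace I) x
  obtain ⟨X, hX, hXv⟩ := exists_contMDiff_section_eventuallyEq I (TangentSpace I (M := M)) x
    (e.continuousLinearMapAt ℝ x v)
  exact ⟨X, hX, hXv.self_of_nhds.trans (e.symmL_continuousLinearMapAt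
    (FiberBundle.mem_baseSet_trivializationAt E (TangentSpace I) x) v)⟩

lemma smoothEnd_of_apply {φ : EndTensor I M}
    (hφ : ∀ X, SmoothField X → SmoothField fun x => φ x (X x)) : SmoothEnd φ :=
  contMDiff_hom_of_apply hφ

lemma smoothOneForm_of_apply {α : OneTensor I M}
    (hα : ∀ X, SmoothField X → ContMDiff I 𝓘(ℝ, ℝ) ∞ fun x => α x (X x)) : SmoothOneForm α :=
  contMDiff_hom_of_apply fun X hX x => (Bundle.contMDiffAt_section _).2 (hα X hX x)

lemma contMDiff_twoTensor_of_apply {σ : TwoTensor I M}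
    (hσ : ∀ X Y, SmoothField X → SmoothField Y →
      ContMDiff I 𝓘(ℝ, ℝ) ∞ fun x => σ x (X x) (Y x)) :
    ContMDiff I (I.prod 𝓘(ℝ, E →L[ℝ] E →L[ℝ] ℝ)) ∞
      (fun x => Bundle.TotalSpace.mk' (E →L[ℝ] E →L[ℝ] ℝ)
        (E := fun x : M => TangentSpace I x →L[ℝ] TangentSpace I x →L[ℝ] Bundle.Trivial M ℝ x)
        x (σ x)) :=
  contMDiff_hom_of_apply fun X hX => smoothOneForm_of_apply (hσ X · hX)

end Fields

/-! ### Tensoriality -/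

section Tensoriality

variable {E : Type*} [NormedAddCommGroup E] [NormedSpace ℝ E]
  {H : Type*} [TopologicalSpace H] {I : ModelWithCorners ℝ E H}
  {M : Type*} [TopologicalSpace M] [ChartedSpace H M]

section dirDeriv

variable {f h : M → ℝ} {x : M}

lemma dirDeriv_const (X : VField I M) (c : ℝ) : dirDeriv X (fun _ => c) x = 0 := by
  rw [dirDeriv, mfderiv_const]
  rfl

lemma dirDeriv_add (X : VField I M) (hf : MDifferentiableAt I 𝓘(ℝ, ℝ) f x)
    (hh : MDifferentiableAt I 𝓘(ℝ, ℝ) h x) :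
    dirDeriv X (fun y => f y + h y) x = dirDeriv X f x + dirDeriv X h x :=
  congrArg (· (X x)) (mvfderiv_add hf hh)

lemma dirDeriv_mul (X : VField I M) (hf : MDifferentiableAt I 𝓘(ℝ, ℝ) f x)
    (hh : MDifferentiableAt I 𝓘(ℝ, ℝ) h x) :
    dirDeriv X (fun y => f y * h y) x = f x * dirDeriv X h x + h x * dirDeriv X f x :=
  congrArg (· (X x)) (mvfderiv_mul hf hh)

lemma dirDeriv_const_mul (X : VField I M) (c : ℝ) (hf : MDifferentiableAt I 𝓘(ℝ, ℝ) f x) :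
    dirDeriv X (fun y => c * f y) x = c * dirDeriv X f x := by
  rw [dirDeriv_mul X mdifferentiableAt_const hf, dirDeriv_const, mul_zero, add_zero]

lemma dirDeriv_neg (X : VField I M) (f : M → ℝ) (x : M) :
    dirDeriv X (fun y => -f y) x = -dirDeriv X f x :=
  congrArg (· (X x)) (mvfderiv_neg (g := f))

end dirDeriv

lemma dOne_swap (α : OneTensor I M) (X Y : VField I M) (x : M) :
    dOne α X Y x = -dOne α Y X x := by
  rw [dOne, dOne, VectorField.mlieBracket_swap_apply, map_neg]
  ring

variable [IsManifold I ∞ M] {x : M}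

lemma mdifferentiableAt_oneForm_apply {α : OneTensor I M} (hα : SmoothOneForm α) {X : VField I M}
    (hX : MDifferentiableAt I I.tangent (fun y => (⟨y, X y⟩ : TangentBundle I M)) x) :
    MDifferentiableAt I 𝓘(ℝ, ℝ) (fun y => α y (X y)) x :=
  (mdifferentiableAt_section _ _).1 ((hα.mdifferentiable (by simp) x).clm_bundle_apply hX)

lemma mdifferentiableAt_metric_apply
    (g : Bundle.ContMDiffRiemannianMetric I ∞ E (fun x : M => TangentSpace I x))
    {X Y : VField I M}
    (hX : MDifferentiableAt I I.tangent (fun y => (⟨y, X y⟩ : TangentBundle I M)) x)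
    (hY : MDifferentiableAt I I.tangent (fun y => (⟨y, Y y⟩ : TangentBundle I M)) x) :
    MDifferentiableAt I 𝓘(ℝ, ℝ) (fun y => g.inner y (X y) (Y y)) x :=
  (mdifferentiableAt_section _ _).1
    ((g.contMDiff.mdifferentiable (by simp) x).clm_bundle_apply₂ hX hY)

variable [FiniteDimensional ℝ E]

lemma mlieBracket_smul_left_apply {f : M → ℝ} {X : VField I M}
    (hf : MDifferentiableAt I 𝓘(ℝ, ℝ) f x)
    (hX : MDifferentiableAt I I.tangent (fun y => (⟨y, X y⟩ : TangentBundle I M)) x)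
    (Y : VField I M) :
    VectorField.mlieBracket I (f • X) Y x
      = f x • VectorField.mlieBracket I X Y x - dirDeriv Y f x • X x := by
  have := FiniteDimensional.complete ℝ E
  rw [VectorField.mlieBracket_smul_left hf hX, neg_smul, neg_add_eq_sub]
  rfl

lemma tensorialAt_dOne {α : OneTensor I M} (hα : SmoothOneForm α) (Y : VField I M) (x : M) :
    TensorialAt I E (fun X => dOne α X Y x) x where
  smul {f X} hf hX := by
    have hfX : dirDeriv Y (fun y => α y ((f • X) y)) x = _ :=
      (congrArg (dirDeriv Y · x) (funext fun y => map_smul (α y) (f y) (X y))).trans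
        (dirDeriv_mul Y hf (mdifferentiableAt_oneForm_apply hα hX))
    have hf' (h : M → ℝ) : dirDeriv (f • X) h x = f x * dirDeriv X h x := map_smul _ _ _
    simp only [dOne]
    rw [mlieBracket_smul_left_apply hf hX, hfX, hf', map_sub, map_smul, map_smul]
    simp only [smul_eq_mul]
    ring
  add {X X'} hX hX' := by
    have := FiniteDimensional.complete ℝ E
    have hXX' : dirDeriv Y (fun y => α y ((X + X') y)) x = _ :=
      (congrArg (dirDeriv Y · x) (funext fun y => map_add (α y) (X y) (X' y))).trans
        (dirDeriv_add Y (mdifferentiableAt_oneForm_apply hα hX)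
          (mdifferentiableAt_oneForm_apply hα hX'))
    have hadd (h : M → ℝ) : dirDeriv (X + X') h x = dirDeriv X h x + dirDeriv X' h x :=
      map_add _ _ _
    simp only [dOne]
    rw [VectorField.mlieBracket_add_left hX hX', hXX', hadd, map_add]
    ring

lemma dOne_congr {α : OneTensor I M} (hα : SmoothOneForm α) {X X' Y Y' : VField I M}
    (hX : SmoothField X) (hX' : SmoothField X') (hY : SmoothField Y) (hY' : SmoothField Y')
    (hXX' : X x = X' x) (hYY' : Y x = Y' x) : dOne α X Y x = dOne α X' Y' x := by
  rw [(tensorialAt_dOne hα Y x).pointwise (hX.mdifferentiableAt x) (hX'.mdifferentiableAt x) hXX',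
    dOne_swap, (tensorialAt_dOne hα X' x).pointwise (hY.mdifferentiableAt x)
      (hY'.mdifferentiableAt x) hYY', ← dOne_swap]

end Tensoriality

namespace AlmostContactMetric

variable {E : Type*} [NormedAddCommGroup E] [NormedSpace ℝ E]
  {H : Type*} [TopologicalSpace H] {I : ModelWithCorners ℝ E H}
  {M : Type*} [TopologicalSpace M] [ChartedSpace H M] [IsManifold I ∞ M]
  (S : AlmostContactMetric I M) {x : M}

lemma smoothOneForm_η : SmoothOneForm S.η := fun x =>
  (S.g.contMDiff x).clm_bundle_apply (S.smooth_ξ x)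

lemma mdifferentiableAt_applyφ {X : VField I M}
    (hX : MDifferentiableAt I I.tangent (fun y => (⟨y, X y⟩ : TangentBundle I M)) x) :
    MDifferentiableAt I I.tangent (fun y => (⟨y, S.applyφ X y⟩ : TangentBundle I M)) x :=
  (S.smooth_φ.mdifferentiable (by simp) x).clm_bundle_apply hX

lemma sasakiHatakeyama_swap (X Y : VField I M) (x : M) :
    S.sasakiHatakeyama X Y x = -S.sasakiHatakeyama Y X x := by
  simp only [sasakiHatakeyama]
  rw [VectorField.mlieBracket_swap_apply (V := S.applyφ X) (W := S.applyφ Y),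
    VectorField.mlieBracket_swap_apply (V := X) (W := Y),
    VectorField.mlieBracket_swap_apply (V := S.applyφ X) (W := Y),
    VectorField.mlieBracket_swap_apply (V := X) (W := S.applyφ Y), dOne_swap]
  simp only [map_neg, neg_smul]
  abel

/-- The Lie derivative of the metric along the Reeb field, evaluated on two vector fields. -/
noncomputable def lieDerivMetric (X Y : VField I M) (x : M) : ℝ :=
  dirDeriv S.ξ (fun y => S.g.inner y (X y) (Y y)) x
    - S.g.inner x (VectorField.mlieBracket I S.ξ X x) (Y x)
    - S.g.inner x (X x) (VectorField.mlieBracket I S.ξ Y x)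

lemma lieDerivMetric_comm (X Y : VField I M) (x : M) :
    S.lieDerivMetric X Y x = S.lieDerivMetric Y X x := by
  have hXY : (fun y => S.g.inner y (X y) (Y y)) = fun y => S.g.inner y (Y y) (X y) :=
    funext fun y => S.g.symm y _ _
  rw [lieDerivMetric, lieDerivMetric, hXY, S.g.symm x (X x), S.g.symm x (Y x)]
  ring

variable [FiniteDimensional ℝ E]

lemma tensorialAt_sasakiHatakeyama (Y : VField I M) (x : M) :
    TensorialAt I E (fun X => S.sasakiHatakeyama X Y x) x where
  smul {f X} hf hX := by
    have hφX : S.applyφ (f • X) = f • S.applyφ X := funext fun y => map_smul _ _ _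
    have hsmul := (tensorialAt_dOne S.smoothOneForm_η Y x).smul hf hX
    simp only [sasakiHatakeyama]
    rw [hφX, hsmul, mlieBracket_smul_left_apply hf hX, mlieBracket_smul_left_apply hf hX,
      mlieBracket_smul_left_apply hf (S.mdifferentiableAt_applyφ hX),
      mlieBracket_smul_left_apply hf (S.mdifferentiableAt_applyφ hX)]
    simp only [map_sub, map_smul, applyφ]
    module
  add {X X'} hX hX' := by
    have := FiniteDimensional.complete ℝ E
    have hφX : S.applyφ (X + X') = S.applyφ X + S.applyφ X' := funext fun y => map_add _ _ _
    have hadd := (tensorialAt_dOne S.smoothOneForm_η Y x).add hX hX'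
    simp only [sasakiHatakeyama]
    rw [hφX, hadd, VectorField.mlieBracket_add_left hX hX',
      VectorField.mlieBracket_add_left hX hX',
      VectorField.mlieBracket_add_left (S.mdifferentiableAt_applyφ hX)
        (S.mdifferentiableAt_applyφ hX'),
      VectorField.mlieBracket_add_left (S.mdifferentiableAt_applyφ hX)
        (S.mdifferentiableAt_applyφ hX')]
    simp only [map_add]
    module

lemma sasakiHatakeyama_congr {X X' Y Y' : VField I M}
    (hX : SmoothField X) (hX' : SmoothField X') (hY : SmoothField Y) (hY' : SmoothField Y')
    (hXX' : X x = X' x) (hYY' : Y x = Y' x) :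
    S.sasakiHatakeyama X Y x = S.sasakiHatakeyama X' Y' x := by
  rw [(S.tensorialAt_sasakiHatakeyama Y x).pointwise (hX.mdifferentiableAt x)
      (hX'.mdifferentiableAt x) hXX', sasakiHatakeyama_swap,
    (S.tensorialAt_sasakiHatakeyama X' x).pointwise (hY.mdifferentiableAt x)
      (hY'.mdifferentiableAt x) hYY', ← sasakiHatakeyama_swap]

lemma tensorialAt_lieDerivMetric {Y : VField I M} (hY : SmoothField Y) (x : M) :
    TensorialAt I E (fun X => S.lieDerivMetric X Y x) x where
  smul {f X} hf hX := by
    have hfX : dirDeriv S.ξ (fun y => S.g.inner y ((f • X) y) (Y y)) x = _ :=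
      (congrArg (dirDeriv S.ξ · x) (funext fun y => by
        rw [Pi.smul_apply', map_smul, smul_apply, smul_eq_mul])).trans
        (dirDeriv_mul S.ξ hf (mdifferentiableAt_metric_apply S.g hX (hY.mdifferentiableAt x)))
    simp only [lieDerivMetric]
    rw [hfX, VectorField.mlieBracket_swap_apply (W := f • X), mlieBracket_smul_left_apply hf hX,
      VectorField.mlieBracket_swap_apply (W := X)]
    simp only [Pi.smul_apply', map_neg, map_sub, map_smul, sub_apply, neg_apply,
      smul_apply, smul_eq_mul]
    ring
  add {X X'} hX hX' := by
    have := FiniteDimensional.complete ℝ E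
    have hXX' : dirDeriv S.ξ (fun y => S.g.inner y ((X + X') y) (Y y)) x = _ :=
      (congrArg (dirDeriv S.ξ · x) (funext fun y => by rw [Pi.add_apply, map_add, add_apply])).trans
        (dirDeriv_add S.ξ (mdifferentiableAt_metric_apply S.g hX (hY.mdifferentiableAt x))
          (mdifferentiableAt_metric_apply S.g hX' (hY.mdifferentiableAt x)))
    simp only [lieDerivMetric]
    rw [hXX', VectorField.mlieBracket_add_right hX hX']
    simp only [Pi.add_apply, map_add, add_apply]
    ring

lemma lieDerivMetric_congr {X X' Y Y' : VField I M}
    (hX : SmoothField X) (hX' : SmoothField X') (hY : SmoothField Y) (hY' : SmoothField Y')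
    (hXX' : X x = X' x) (hYY' : Y x = Y' x) :
    S.lieDerivMetric X Y x = S.lieDerivMetric X' Y' x := by
  rw [(S.tensorialAt_lieDerivMetric hY x).pointwise (hX.mdifferentiableAt x)
      (hX'.mdifferentiableAt x) hXX', lieDerivMetric_comm,
    (S.tensorialAt_lieDerivMetric hX' x).pointwise (hY.mdifferentiableAt x)
      (hY'.mdifferentiableAt x) hYY', ← lieDerivMetric_comm]

end AlmostContactMetric

/-! ### Consequences of normality -/

namespace AlmostContactMetric

variable {E : Type*} [NormedAddCommGroup E] [NormedSpace ℝ E]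
  {H : Type*} [TopologicalSpace H] {I : ModelWithCorners ℝ E H}
  {M : Type*} [TopologicalSpace M] [ChartedSpace H M] [IsManifold I ∞ M]
  (S : AlmostContactMetric I M) {U V : VField I M}

lemma φ_φ_eq (x : M) (v : TangentSpace I x) : S.φ x (S.φ x v) = -v + S.η x v • S.ξ x :=
  S.φ_φ x v

lemma η_ξ (x : M) : S.η x (S.ξ x) = 1 :=
  S.unit_ξ x

lemma η_φ (x : M) (v : TangentSpace I x) : S.η x (S.φ x v) = 0 := by
  have h := S.φ_φ_eq x (S.φ x v)
  rw [S.φ_φ_eq x v, map_add, map_neg, map_smul, S.φ_ξ, smul_zero, add_zero,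
    left_eq_add] at h
  simpa only [map_smul, S.η_ξ, smul_eq_mul, mul_one, map_zero] using congrArg (S.η x) h

lemma smoothField_applyφ (hU : SmoothField U) : SmoothField (S.applyφ U) :=
  S.smooth_φ.apply hU

/-- The vector field `φ(X) + bξ`: on a torus bundle it is the projection of the value of the lifted
endomorphism on a field over `X` whose coordinate along the second vertical field is `b`. -/
noncomputable def shiftedφ (b : ℝ) (X : VField I M) : VField I M := S.applyφ X + b • S.ξ

lemma shiftedφ_apply (b : ℝ) (X : VField I M) (x : M) :
    S.shiftedφ b X x = S.φ x (X x) + b • S.ξ x := rfl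

lemma η_shiftedφ (b : ℝ) (X : VField I M) (x : M) : S.η x (S.shiftedφ b X x) = b := by
  rw [shiftedφ_apply, map_add, map_smul, S.η_φ, S.η_ξ, zero_add, smul_eq_mul, mul_one]

lemma smoothField_shiftedφ (b : ℝ) (hU : SmoothField U) : SmoothField (S.shiftedφ b U) :=
  (S.smoothField_applyφ hU).add_section (S.smooth_ξ.const_smul_section (a := b))

lemma sasakiHatakeyama_ξ_left (V : VField I M) (x : M) :
    S.sasakiHatakeyama S.ξ V x = S.φ x (S.φ x (VectorField.mlieBracket I S.ξ V x))
      - S.φ x (VectorField.mlieBracket I S.ξ (S.applyφ V) x) + dOne S.η S.ξ V x • S.ξ x := by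
  have hξ : S.applyφ S.ξ = 0 := funext S.φ_ξ
  simp only [sasakiHatakeyama, hξ, VectorField.mlieBracket_zero_left, Pi.zero_apply, map_zero,
    zero_add, sub_zero]

section

variable [FiniteDimensional ℝ E]

lemma mlieBracket_shiftedφ_left (b : ℝ) (hU : SmoothField U) (V : VField I M) (x : M) :
    VectorField.mlieBracket I (S.shiftedφ b U) V x
      = VectorField.mlieBracket I (S.applyφ U) V x + b • VectorField.mlieBracket I S.ξ V x := by
  have := FiniteDimensional.complete ℝ E
  have hξ := S.smooth_ξ.mdifferentiableAt x
  rw [shiftedφ, VectorField.mlieBracket_add_left ((S.smoothField_applyφ hU).mdifferentiableAt x)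
    (hξ.smul_const_section), VectorField.mlieBracket_const_smul_left hξ]

lemma mlieBracket_shiftedφ_right (d : ℝ) (U : VField I M) (hV : SmoothField V) (x : M) :
    VectorField.mlieBracket I U (S.shiftedφ d V) x
      = VectorField.mlieBracket I U (S.applyφ V) x + d • VectorField.mlieBracket I U S.ξ x := by
  rw [VectorField.mlieBracket_swap_apply, mlieBracket_shiftedφ_left _ _ hV,
    VectorField.mlieBracket_swap_apply (V := U), VectorField.mlieBracket_swap_apply (V := U)]
  module

lemma dOne_η_shiftedφ_left (b : ℝ) (hU : SmoothField U) (V : VField I M) (x : M) :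
    dOne S.η (S.shiftedφ b U) V x = dOne S.η (S.applyφ U) V x + b * dOne S.η S.ξ V x := by
  have h := tensorialAt_dOne S.smoothOneForm_η V x
  have hξ := S.smooth_ξ.mdifferentiableAt x
  have hsmul := h.smul (f := fun _ => b) mdifferentiableAt_const hξ
  exact (h.add ((S.smoothField_applyφ hU).mdifferentiableAt x)
    (hξ.smul_const_section)).trans (congrArg (_ + ·) hsmul)

end

namespace IsNormal

variable {S}

lemma η_mlieBracket_applyφ (hS : S.IsNormal) (hU : SmoothField U) (hV : SmoothField V) (x : M) :
    S.η x (VectorField.mlieBracket I (S.applyφ U) (S.applyφ V) x) = -dOne S.η U V x := by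
  have h := congrArg (S.η x) (hS U V hU hV x)
  simp only [sasakiHatakeyama, map_add, map_sub, map_smul, map_zero, S.η_φ, S.η_ξ,
    smul_eq_mul] at h
  linarith

lemma dOne_η_applyφ_applyφ (hS : S.IsNormal) (hU : SmoothField U) (hV : SmoothField V) (x : M) :
    dOne S.η (S.applyφ U) (S.applyφ V) x = dOne S.η U V x := by
  have hη (X : VField I M) : (fun y => S.η y (S.applyφ X y)) = fun _ => 0 :=
    funext fun y => S.η_φ y (X y)
  rw [dOne, hS.η_mlieBracket_applyφ hU hV, hη, hη, dirDeriv_const, dirDeriv_const]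
  ring

variable [FiniteDimensional ℝ E]

lemma dOne_η_ξ_left (hS : S.IsNormal) (hV : SmoothField V) (x : M) :
    dOne S.η S.ξ V x = 0 := by
  rw [← hS.dOne_η_applyφ_applyφ S.smooth_ξ hV, show S.applyφ S.ξ = 0 from funext S.φ_ξ]
  exact (tensorialAt_dOne S.smoothOneForm_η _ x).zero

lemma mlieBracket_ξ_applyφ (hS : S.IsNormal) (hV : SmoothField V) (x : M) :
    VectorField.mlieBracket I S.ξ (S.applyφ V) x
      = S.φ x (VectorField.mlieBracket I S.ξ V x) := by
  set W := VectorField.mlieBracket I S.ξ (S.applyφ V) x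
  have hηW : S.η x W = 0 := by
    have h := hS.dOne_η_ξ_left (S.smoothField_applyφ hV) x
    have hφV : (fun y => S.η y (S.applyφ V y)) = fun _ => 0 := funext fun y => S.η_φ y (V y)
    have hξ : (fun y => S.η y (S.ξ y)) = fun _ => 1 := funext S.η_ξ
    rw [dOne, hφV, hξ, dirDeriv_const, dirDeriv_const] at h
    linarith
  have hφW : S.φ x W = S.φ x (S.φ x (VectorField.mlieBracket I S.ξ V x)) := by
    have h := hS S.ξ V S.smooth_ξ hV x
    rw [sasakiHatakeyama_ξ_left, hS.dOne_η_ξ_left hV, zero_smul, add_zero, sub_eq_zero] at h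
    exact h.symm
  have h := congrArg (S.φ x) hφW
  rw [S.φ_φ_eq, S.φ_φ_eq, hηW, S.η_φ] at h
  simpa only [zero_smul, add_zero, neg_inj] using h

lemma dOne_η_applyφ_add (hS : S.IsNormal) (hU : SmoothField U) (hV : SmoothField V) (x : M) :
    dOne S.η (S.applyφ U) V x + dOne S.η U (S.applyφ V) x = 0 := by
  have hUx := hU.mdifferentiableAt x
  have hηU := (S.smoothOneForm_η.apply hU).mdifferentiable (by simp) x
  have hξ := S.smooth_ξ.mdifferentiableAt x
  have hneg :=
    mdifferentiableAt_const (I := I) (I' := 𝓘(ℝ, ℝ)) (M := M) (x := x) (c := (-1 : ℝ))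
  have h := tensorialAt_dOne S.smoothOneForm_η (S.applyφ V) x
  have hφφU : S.applyφ (S.applyφ U)
      = (fun _ : M => (-1 : ℝ)) • U + (fun y => S.η y (U y)) • S.ξ := by
    funext y
    change S.φ y (S.φ y (U y)) = (-1 : ℝ) • U y + S.η y (U y) • S.ξ y
    rw [S.φ_φ_eq, neg_one_smul]
  rw [← hS.dOne_η_applyφ_applyφ (S.smoothField_applyφ hU) hV, hφφU,
    h.add (hneg.smul_section hUx) (hηU.smul_section hξ), h.smul hneg hUx, h.smul hηU hξ,
    hS.dOne_η_ξ_left (S.smoothField_applyφ hV), smul_zero, neg_one_smul, add_zero, neg_add_cancel]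

lemma dOne_η_shiftedφ_add (hS : S.IsNormal) (hU : SmoothField U) (hV : SmoothField V)
    (b d : ℝ) (x : M) :
    dOne S.η (S.shiftedφ b U) V x + dOne S.η U (S.shiftedφ d V) x = 0 := by
  rw [dOne_η_shiftedφ_left _ _ hU, dOne_swap _ U, dOne_η_shiftedφ_left _ _ hV,
    hS.dOne_η_ξ_left hU, hS.dOne_η_ξ_left hV, mul_zero, mul_zero, add_zero, add_zero,
    ← dOne_swap, hS.dOne_η_applyφ_add hU hV]

lemma mlieBracket_shiftedφ_ξ (hS : S.IsNormal) (hU : SmoothField U) (b : ℝ) (x : M) :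
    VectorField.mlieBracket I (S.shiftedφ b U) S.ξ x
      = S.φ x (VectorField.mlieBracket I U S.ξ x) := by
  have hξ : VectorField.mlieBracket I S.ξ S.ξ x = 0 :=
    congrFun VectorField.mlieBracket_self x
  rw [mlieBracket_shiftedφ_left _ _ hU, hξ, smul_zero, add_zero,
    VectorField.mlieBracket_swap_apply, hS.mlieBracket_ξ_applyφ hU, ← map_neg,
    ← VectorField.mlieBracket_swap_apply]

lemma mlieBracket_shiftedφ (hS : S.IsNormal) (hU : SmoothField U) (hV : SmoothField V)
    (b d : ℝ) (x : M) :
    VectorField.mlieBracket I (S.shiftedφ b U) (S.shiftedφ d V) x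
      = VectorField.mlieBracket I U V x
        + S.φ x (VectorField.mlieBracket I (S.shiftedφ b U) V x)
        + S.φ x (VectorField.mlieBracket I U (S.shiftedφ d V) x)
        - (dirDeriv U (fun y => S.η y (V y)) x - dirDeriv V (fun y => S.η y (U y)) x)
          • S.ξ x := by
  have hSH := hS U V hU hV x
  rw [sasakiHatakeyama, S.φ_φ_eq, dOne] at hSH
  rw [mlieBracket_shiftedφ_right _ _ _ hV, hS.mlieBracket_shiftedφ_ξ hU,
    mlieBracket_shiftedφ_right _ _ _ hV, mlieBracket_shiftedφ_left _ _ hU,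
    mlieBracket_shiftedφ_left _ _ hU, hS.mlieBracket_ξ_applyφ hV, ← sub_eq_zero, ← hSH]
  simp only [map_add, map_smul]
  module

end IsNormal
end AlmostContactMetric

/-! ### Splittings of the tangent spaces of a bundle -/

section Splitting

variable {E : Type*} [NormedAddCommGroup E] [NormedSpace ℝ E]
  {H : Type*} [TopologicalSpace H] {I : ModelWithCorners ℝ E H}
  {M : Type*} [TopologicalSpace M] [ChartedSpace H M]
  {E' : Type*} [NormedAddCommGroup E'] [NormedSpace ℝ E']
  {H' : Type*} [TopologicalSpace H'] {I' : ModelWithCorners ℝ E' H'}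
  {P : Type*} [TopologicalSpace P] [ChartedSpace H' P]

lemma contMDiff_add_smul_along [IsManifold I ∞ M] {π : P → M} {v w : ∀ q, TangentSpace I (π q)}
    {f : P → ℝ} (hv : ContMDiff I' I.tangent ∞ fun q => (⟨π q, v q⟩ : TangentBundle I M))
    (hf : ContMDiff I' 𝓘(ℝ, ℝ) ∞ f)
    (hw : ContMDiff I' I.tangent ∞ fun q => (⟨π q, w q⟩ : TangentBundle I M)) :
    ContMDiff I' I.tangent ∞ fun q => (⟨π q, v q + f q • w q⟩ : TangentBundle I M) := by
  intro p
  have hvp := Bundle.contMDiffAt_totalSpace.1 (hv p)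
  have hwp := Bundle.contMDiffAt_totalSpace.1 (hw p)
  refine Bundle.contMDiffAt_totalSpace.2
    ⟨hvp.1, (hvp.2.add ((hf p).smul hwp.2)).congr_of_eventuallyEq ?_⟩
  let e := trivializationAt E (TangentSpace I) (π p)
  filter_upwards [hvp.1.continuousAt (e.open_baseSet.mem_nhds
    (FiberBundle.mem_baseSet_trivializationAt E (TangentSpace I) (π p)))] with q hq
  have hlin := e.linear ℝ hq
  exact (hlin.map_add _ _).trans (congrArg _ (hlin.map_smul _ _))

variable [IsManifold I' ∞ P]

variable (I) in
/-- The `1`-forms `α`, `β` on the total space of `π : P → M` split the tangent spaces of `P`: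
`v ↦ (π_* v, α(v), β(v))` identifies each of them with a tangent space of `M` times `ℝ²`. -/
structure IsSplitting (π : P → M) (α β : OneTensor I' P) : Prop where
  smooth_proj : ContMDiff I' I ∞ π
  smooth_fst : SmoothOneForm α
  smooth_snd : SmoothOneForm β
  bijective : ∀ p, Function.Bijective ((mfderiv I' I π p).prod ((α p).prod (β p)))

namespace IsSplitting

variable {π : P → M} {α β : OneTensor I' P}

lemma contMDiff_proj [IsManifold I ∞ M] (h : IsSplitting I π α β) {X : VField I' P}
    (hX : SmoothField X) :
    ContMDiff I' I.tangent ∞ fun q => (⟨π q, mfderiv I' I π q (X q)⟩ : TangentBundle I M) :=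
  (h.smooth_proj.contMDiff_tangentMap (m := ∞) (by simp)).comp hX

lemma contMDiffAt_coords [IsManifold I ∞ M] (h : IsSplitting I π α β) {X : VField I' P} {p : P}
    (hX : ContMDiffAt I' I'.tangent ∞ (fun q => (⟨q, X q⟩ : TangentBundle I' P)) p) :
    ContMDiffAt I' 𝓘(ℝ, E × ℝ × ℝ) ∞
      (fun q => ((trivializationAt E (TangentSpace I) (π p) ⟨π q, mfderiv I' I π q (X q)⟩).2,
        α q (X q), β q (X q))) p := by
  have hproj : ContMDiffAt I' I.tangent ∞
      (fun q => (⟨π q, mfderiv I' I π q (X q)⟩ : TangentBundle I M)) p :=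
    (h.smooth_proj.contMDiff_tangentMap (m := ∞) (by simp)).contMDiffAt.comp p hX
  have hfst := (Bundle.contMDiffAt_section _).1 ((h.smooth_fst p).clm_bundle_apply hX)
  have hsnd := (Bundle.contMDiffAt_section _).1 ((h.smooth_snd p).clm_bundle_apply hX)
  exact (Bundle.contMDiffAt_totalSpace.1 hproj).2.prodMk_space (hfst.prodMk_space hsnd)

variable [FiniteDimensional ℝ E']

/-- The splitting of the tangent space at `p`, as a linear equivalence. -/
noncomputable def equiv (h : IsSplitting I π α β) (p : P) :
    TangentSpace I' p ≃L[ℝ] TangentSpace I (π p) × ℝ × ℝ :=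
  have : FiniteDimensional ℝ (TangentSpace I' p) := inferInstanceAs (FiniteDimensional ℝ E')
  have : T2Space (TangentSpace I' p) := inferInstanceAs (T2Space E')
  have : T2Space (TangentSpace I (π p)) := inferInstanceAs (T2Space E)
  (LinearEquiv.ofBijective _ (h.bijective p)).toContinuousLinearEquiv

lemma equiv_apply (h : IsSplitting I π α β) (p : P) (v : TangentSpace I' p) :
    h.equiv p v = (mfderiv I' I π p v, α p v, β p v) := rfl

/-- The vector field projecting to `U` with `α = a ∘ π` and `β = b ∘ π`. -/
noncomputable def lift (h : IsSplitting I π α β) (U : VField I M) (a b : M → ℝ) : VField I' P :=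
  fun p => (h.equiv p).symm (U (π p), a (π p), b (π p))

/-- The vertical vector field dual to `α`. -/
noncomputable def fstField (h : IsSplitting I π α β) : VField I' P :=
  h.lift 0 (fun _ => 1) (fun _ => 0)

/-- The vertical vector field dual to `β`. -/
noncomputable def sndField (h : IsSplitting I π α β) : VField I' P :=
  h.lift 0 (fun _ => 0) (fun _ => 1)

section lift

variable (h : IsSplitting I π α β) (p : P) (U : VField I M) (a b : M → ℝ)

lemma equiv_lift : h.equiv p (h.lift U a b p) = (U (π p), a (π p), b (π p)) :=
  (h.equiv p).apply_symm_apply _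

lemma mfderiv_lift : mfderiv I' I π p (h.lift U a b p) = U (π p) :=
  congrArg Prod.fst (h.equiv_lift p U a b)

lemma fst_lift : α p (h.lift U a b p) = a (π p) :=
  congrArg (·.2.1) (h.equiv_lift p U a b)

lemma snd_lift : β p (h.lift U a b p) = b (π p) :=
  congrArg (·.2.2) (h.equiv_lift p U a b)

lemma mfderiv_fstField : mfderiv I' I π p (h.fstField p) = 0 := h.mfderiv_lift p _ _ _

lemma fst_fstField : α p (h.fstField p) = 1 := h.fst_lift p _ _ _

lemma snd_fstField : β p (h.fstField p) = 0 := h.snd_lift p _ _ _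

lemma mfderiv_sndField : mfderiv I' I π p (h.sndField p) = 0 := h.mfderiv_lift p _ _ _

lemma fst_sndField : α p (h.sndField p) = 0 := h.fst_lift p _ _ _

lemma snd_sndField : β p (h.sndField p) = 1 := h.snd_lift p _ _ _

end lift

lemma ext_of_coords (h : IsSplitting I π α β) {p : P} {v w : TangentSpace I' p}
    (hproj : mfderiv I' I π p v = mfderiv I' I π p w) (hfst : α p v = α p w)
    (hsnd : β p v = β p w) : v = w :=
  (h.equiv p).injective (Prod.ext hproj (Prod.ext hfst hsnd))

variable [IsManifold I ∞ M]

lemma smoothField_of_coords (h : IsSplitting I π α β) {X : VField I' P}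
    (hX : ContMDiff I' I.tangent ∞ fun q => (⟨π q, mfderiv I' I π q (X q)⟩ : TangentBundle I M))
    (hα : ContMDiff I' 𝓘(ℝ, ℝ) ∞ fun q => α q (X q))
    (hβ : ContMDiff I' 𝓘(ℝ, ℝ) ∞ fun q => β q (X q)) : SmoothField X := by
  intro p
  have := FiniteDimensional.complete ℝ E'
  let e := trivializationAt E (TangentSpace I) (π p)
  let e' := trivializationAt E' (TangentSpace I') p
  have hp : p ∈ e'.baseSet := FiberBundle.mem_baseSet_trivializationAt E' (TangentSpace I') p
  have hπp : π p ∈ e.baseSet := FiberBundle.mem_baseSet_trivializationAt E (TangentSpace I) (π p)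
  let A (q : P) : E' →L[ℝ] E × ℝ × ℝ :=
    ((e.continuousLinearMapAt ℝ (π q)).prodMap (.id ℝ (ℝ × ℝ))).comp
      ((h.equiv q : TangentSpace I' q →L[ℝ] _).comp (e'.symmL ℝ q))
  have hA_apply : ∀ᶠ q in nhds p, ∀ w, A q w =
      ((e ⟨π q, mfderiv I' I π q (e'.symmL ℝ q w)⟩).2, α q (e'.symmL ℝ q w),
        β q (e'.symmL ℝ q w)) := by
    filter_upwards [h.smooth_proj.continuous.continuousAt (e.open_baseSet.mem_nhds hπp)] with q hq w
    rw [← e.continuousLinearMapAt_apply_of_mem ℝ hq]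
    rfl
  have hA : ContMDiffAt I' 𝓘(ℝ, E' →L[ℝ] E × ℝ × ℝ) ∞ A p := by
    refine contMDiffAt_clm_of_apply fun w => ?_
    have hw := (contMDiffOn_trivializationAt_symmL I' (V := TangentSpace I') p w).contMDiffAt
      (e'.open_baseSet.mem_nhds hp)
    exact (h.contMDiffAt_coords hw).congr_of_eventuallyEq (hA_apply.mono fun q hq => hq w)
  have hinv : (A p).IsInvertible :=
    ⟨(e'.continuousLinearEquivAt ℝ p hp).symm.trans ((h.equiv p).trans
      ((e.continuousLinearEquivAt ℝ (π p) hπp).prodCongr (.refl ℝ (ℝ × ℝ)))),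
      ContinuousLinearMap.ext fun w => by
        rw [hA_apply.self_of_nhds w, ← e'.symm_continuousLinearEquivAt_eq hp]
        rfl⟩
  refine (Bundle.contMDiffAt_section _).2 (contMDiffAt_of_clm_apply hA hinv ?_)
  refine ((Bundle.contMDiffAt_totalSpace.1 (hX p)).2.prodMk_space
    ((hα p).prodMk_space (hβ p))).congr_of_eventuallyEq ?_
  filter_upwards [hA_apply, e'.open_baseSet.mem_nhds hp] with q hAq hq
  have hXq : e'.symmL ℝ q (e' ⟨q, X q⟩).2 = X q := by
    rw [← e'.continuousLinearMapAt_apply_of_mem ℝ hq, e'.symmL_continuousLinearMapAt hq]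
  rw [hAq, hXq]

lemma smoothField_lift (h : IsSplitting I π α β) {U : VField I M} (hU : SmoothField U)
    {a b : M → ℝ} (ha : ContMDiff I 𝓘(ℝ, ℝ) ∞ a) (hb : ContMDiff I 𝓘(ℝ, ℝ) ∞ b) :
    SmoothField (h.lift U a b) := by
  refine h.smoothField_of_coords ?_ ?_ ?_
  · simp only [mfderiv_lift]
    exact hU.comp h.smooth_proj
  · simp only [fst_lift]
    exact ha.comp h.smooth_proj
  · simp only [snd_lift]
    exact hb.comp h.smooth_proj

variable [FiniteDimensional ℝ E] [T2Space M]

lemma exists_lift_const_eq (h : IsSplitting I π α β) {p : P} (v : TangentSpace I' p) :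
    ∃ (U : VField I M) (a b : ℝ), SmoothField U ∧ h.lift U (fun _ => a) (fun _ => b) p = v := by
  obtain ⟨U, hU, hUp⟩ := exists_smoothField_apply_eq (mfderiv I' I π p v)
  exact ⟨U, α p v, β p v, hU, (h.equiv p).injective (by rw [equiv_lift, hUp, equiv_apply])⟩

end IsSplitting
end Splitting

section TotalStructure

variable {E : Type*} [NormedAddCommGroup E] [NormedSpace ℝ E]
  {H : Type*} [TopologicalSpace H] {I : ModelWithCorners ℝ E H}
  {M : Type*} [TopologicalSpace M] [ChartedSpace H M] [IsManifold I ∞ M]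
  {E' : Type*} [NormedAddCommGroup E'] [NormedSpace ℝ E']
  {H' : Type*} [TopologicalSpace H'] {I' : ModelWithCorners ℝ E' H'}
  {P : Type*} [TopologicalSpace P] [ChartedSpace H' P] {π : P → M} {α β : OneTensor I' P}

lemma AlmostContactMetric.inner_φ_add_smul_ξ (S : AlmostContactMetric I M) (x : M)
    (v w : TangentSpace I x) (b d : ℝ) :
    S.g.inner x (S.φ x v + b • S.ξ x) (S.φ x w + d • S.ξ x)
      = S.g.inner x v w - S.η x v * S.η x w + b * d := by
  have hφξ (u : TangentSpace I x) : S.g.inner x (S.φ x u) (S.ξ x) = 0 :=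
    (S.g.symm x _ _).trans (S.η_φ x u)
  have hξφ (u : TangentSpace I x) : S.g.inner x (S.ξ x) (S.φ x u) = 0 := S.η_φ x u
  simp only [map_add, map_smul, add_apply, smul_apply, smul_eq_mul, S.g_φ_φ, S.unit_ξ, hφξ, hξφ,
    AlmostContactMetric.η]
  ring

namespace IsSplitting

section

variable (π α β) in
/-- The metric `α² + β² + π^* g` on the total space. -/
noncomputable def metric (S : AlmostContactMetric I M) : TwoTensor I' P := fun p =>
  (α p).smulRight (α p) + (β p).smulRight (β p)
    + ((mfderiv I' I π p).precomp ℝ).comp ((S.g.inner (π p)).comp (mfderiv I' I π p))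

lemma metric_apply (S : AlmostContactMetric I M) (p : P) (v w : TangentSpace I' p) :
    metric π α β S p v w = α p v * α p w + β p v * β p w
      + S.g.inner (π p) (mfderiv I' I π p v) (mfderiv I' I π p w) := rfl

lemma metric_rotate (α β : OneTensor I' P) {s t : ℝ} (hst : s ^ 2 + t ^ 2 = 1)
    (S : AlmostContactMetric I M) (p : P) (v w : TangentSpace I' p) :
    metric π (fun p => t • α p + s • β p) (fun p => -s • α p + t • β p) S p v w
      = metric π α β S p v w := by
  simp only [metric_apply, add_apply, smul_apply, smul_eq_mul]
  linear_combination (α p v * α p w + β p v * β p w) * hst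

end

variable [FiniteDimensional ℝ E'] [IsManifold I' ∞ P]

section

variable (S : AlmostContactMetric I M) (p : P)

lemma metric_pos (h : IsSplitting I π α β) (v : TangentSpace I' p) (hv : v ≠ 0) :
    0 < metric π α β S p v v := by
  rw [metric_apply]
  have hα := mul_self_nonneg (α p v)
  have hβ := mul_self_nonneg (β p v)
  rcases eq_or_ne (mfderiv I' I π p v) 0 with hproj | hproj
  · have hαβ : α p v ≠ 0 ∨ β p v ≠ 0 := by
      by_contra! hzero
      exact hv (h.ext_of_coords (hproj.trans (map_zero _).symm) (hzero.1.trans (map_zero _).symm)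
        (hzero.2.trans (map_zero _).symm))
    rw [hproj, map_zero, add_zero]
    rcases hαβ with hne | hne <;> linarith [mul_self_pos.2 hne]
  · linarith [S.g.pos (π p) _ hproj]

lemma isVonNBounded_metric (h : IsSplitting I π α β) :
    Bornology.IsVonNBounded ℝ {v : TangentSpace I' p | metric π α β S p v v < 1} := by
  have hIcc : Bornology.IsBounded (Set.Icc (-1 : ℝ) 1) := Metric.isBounded_Icc _ _
  have hball : Bornology.IsBounded ({u : E | S.g.inner (π p) u u < 1}) :=
    (NormedSpace.isVonNBounded_iff ℝ).1 (S.g.isVonNBounded (π p))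
  have hprod : Bornology.IsVonNBounded ℝ
      ({u : TangentSpace I (π p) | S.g.inner (π p) u u < 1}
        ×ˢ Set.Icc (-1 : ℝ) 1 ×ˢ Set.Icc (-1 : ℝ) 1) :=
    (NormedSpace.isVonNBounded_iff ℝ (E := E × ℝ × ℝ)).2 (hball.prod (hIcc.prod hIcc))
  have himage := hprod.image ((h.equiv p).symm : _ →L[ℝ] TangentSpace I' p)
  refine himage.subset fun v hv => ?_
  refine ⟨h.equiv p v, ?_, (h.equiv p).symm_apply_apply v⟩
  rw [Set.mem_ofPred_eq, metric_apply] at hv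
  have hproj : 0 ≤ S.g.inner (π p) (mfderiv I' I π p v) (mfderiv I' I π p v) := by
    rcases eq_or_ne (mfderiv I' I π p v) 0 with h0 | h0
    · rw [h0, map_zero]
    · exact (S.g.pos _ _ h0).le
  have hα := mul_self_nonneg (α p v)
  have hβ := mul_self_nonneg (β p v)
  refine ⟨show S.g.inner (π p) (mfderiv I' I π p v) (mfderiv I' I π p v) < 1 by linarith,
    abs_le.1 (abs_le_one_iff_mul_self_le_one.2 (show α p v * α p v ≤ 1 by linarith)),
    abs_le.1 (abs_le_one_iff_mul_self_le_one.2 (show β p v * β p v ≤ 1 by linarith))⟩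

lemma metric_fstField (h : IsSplitting I π α β) (v : TangentSpace I' p) :
    metric π α β S p (h.fstField p) v = α p v := by
  rw [metric_apply, fst_fstField, snd_fstField, mfderiv_fstField, map_zero, zero_apply, one_mul,
    zero_mul, add_zero, add_zero]

end

section

variable (h : IsSplitting I π α β) (S : AlmostContactMetric I M) (p : P)
  (v : TangentSpace I' p)

/-- The endomorphism `φ + β ⊗ ξ - η ⊗ χ` of the tangent bundle of the total space, where `χ` is the
vertical vector field dual to `β`, and `φ`, `ξ` are lifted to `ker α ∩ ker β`. -/
noncomputable def endo : EndTensor I' P := fun p =>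
  ((h.equiv p).symm : _ →L[ℝ] TangentSpace I' p).comp
    (((S.φ (π p)).comp (mfderiv I' I π p) + (β p).smulRight (S.ξ (π p))).prod
      ((0 : TangentSpace I' p →L[ℝ] ℝ).prod (-(S.η (π p)).comp (mfderiv I' I π p))))

lemma equiv_endo : h.equiv p (h.endo S p v)
    = (S.φ (π p) (mfderiv I' I π p v) + β p v • S.ξ (π p), 0, -S.η (π p) (mfderiv I' I π p v)) :=
  (h.equiv p).apply_symm_apply _

lemma mfderiv_endo : mfderiv I' I π p (h.endo S p v)
    = S.φ (π p) (mfderiv I' I π p v) + β p v • S.ξ (π p) :=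
  congrArg Prod.fst (h.equiv_endo S p v)

lemma fst_endo : α p (h.endo S p v) = 0 :=
  congrArg (·.2.1) (h.equiv_endo S p v)

lemma snd_endo : β p (h.endo S p v) = -S.η (π p) (mfderiv I' I π p v) :=
  congrArg (·.2.2) (h.equiv_endo S p v)

lemma endo_lift (U : VField I M) (a : M → ℝ) (b : ℝ) : h.endo S p (h.lift U a (fun _ => b) p)
    = h.lift (S.shiftedφ b U) (fun _ => 0) (fun x => -S.η x (U x)) p :=
  (h.equiv p).injective (by
    rw [equiv_endo, equiv_lift, mfderiv_lift, snd_lift, S.shiftedφ_apply])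

end

section Smooth

variable [T2Space P]

lemma contMDiff_metric (h : IsSplitting I π α β) (S : AlmostContactMetric I M) :
    ContMDiff I' (I'.prod 𝓘(ℝ, E' →L[ℝ] E' →L[ℝ] ℝ)) ∞
      (fun p => Bundle.TotalSpace.mk' (E' →L[ℝ] E' →L[ℝ] ℝ)
        (E := fun p : P => TangentSpace I' p →L[ℝ] TangentSpace I' p →L[ℝ] Bundle.Trivial P ℝ p)
        p (metric π α β S p)) := by
  refine contMDiff_twoTensor_of_apply fun X Y hX hY => ?_
  have hg : ContMDiff I' 𝓘(ℝ, ℝ) ∞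
      fun q => S.g.inner (π q) (mfderiv I' I π q (X q)) (mfderiv I' I π q (Y q)) := fun q =>
    (Bundle.contMDiffAt_totalSpace.1
      ((S.g.contMDiff.comp h.smooth_proj q).clm_bundle_apply₂ (F₃ := ℝ)
        (E₃ := Bundle.Trivial M ℝ) (h.contMDiff_proj hX q) (h.contMDiff_proj hY q))).2
  exact (((h.smooth_fst.apply hX).mul (h.smooth_fst.apply hY)).add
    ((h.smooth_snd.apply hX).mul (h.smooth_snd.apply hY))).add hg

lemma smoothEnd_endo (h : IsSplitting I π α β) (S : AlmostContactMetric I M) :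
    SmoothEnd (h.endo S) := by
  refine smoothEnd_of_apply fun X hX => h.smoothField_of_coords ?_ ?_ ?_
  · simp only [mfderiv_endo]
    exact contMDiff_add_smul_along (fun q => (S.smooth_φ.comp h.smooth_proj q).clm_bundle_apply
      (h.contMDiff_proj hX q)) (h.smooth_snd.apply hX) (S.smooth_ξ.comp h.smooth_proj)
  · simp only [fst_endo]
    exact contMDiff_const
  · simp only [snd_endo]
    exact ContMDiff.neg fun q => (Bundle.contMDiffAt_totalSpace.1
      ((S.smoothOneForm_η.comp h.smooth_proj q).clm_bundle_apply (F₂ := ℝ)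
        (E₂ := Bundle.Trivial M ℝ) (h.contMDiff_proj hX q))).2

/-- The almost contact metric structure on the total space with metric `α² + β² + π^* g`, whose Reeb
field is the vertical field dual to `α`. -/
noncomputable def totalStructure (h : IsSplitting I π α β) (S : AlmostContactMetric I M) :
    AlmostContactMetric I' P where
  g :=
    { inner := metric π α β S
      symm := fun p v w => by
        rw [metric_apply, metric_apply, S.g.symm]
        ring
      pos := fun p => metric_pos S p h
      isVonNBounded := fun p => isVonNBounded_metric S p h
      contMDiff := h.contMDiff_metric S }
  ξ := h.fstField
  φ := h.endo S
  smooth_ξ := h.smoothField_lift (Bundle.contMDiff_zeroSection ℝ (TangentSpace I)) contMDiff_const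
    contMDiff_const
  smooth_φ := h.smoothEnd_endo S
  unit_ξ := fun p => by
    rw [metric_fstField S p h, fst_fstField]
  φ_ξ := fun p => h.ext_of_coords
    (by rw [mfderiv_endo, mfderiv_fstField, snd_fstField, map_zero, map_zero, zero_smul, add_zero])
    (by rw [fst_endo, map_zero])
    (by rw [snd_endo, mfderiv_fstField, map_zero, neg_zero, map_zero])
  φ_φ := fun p v => by
    rw [metric_fstField S p h]
    refine h.ext_of_coords ?_ ?_ ?_
    · rw [mfderiv_endo, mfderiv_endo, snd_endo, map_add, map_smul, S.φ_φ_eq, S.φ_ξ, map_add,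
        map_smul, mfderiv_fstField, map_neg]
      module
    · rw [fst_endo, map_add, map_neg, map_smul, fst_fstField, smul_eq_mul]
      ring
    · rw [snd_endo, mfderiv_endo, map_add, map_smul, S.η_φ, S.η_ξ, map_add, map_neg, map_smul,
        snd_fstField, smul_eq_mul, smul_eq_mul]
      ring
  g_φ_φ := fun p v w => by
    rw [metric_fstField S p h, metric_fstField S p h, metric_apply, metric_apply, fst_endo,
      snd_endo, snd_endo, mfderiv_endo, mfderiv_endo, S.inner_φ_add_smul_ξ]
    ring

end Smooth
end IsSplitting
end TotalStructure

/-! ### Brackets of lifted vector fields -/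

section Curvature

variable {E : Type*} [NormedAddCommGroup E] [NormedSpace ℝ E]
  {H : Type*} [TopologicalSpace H] {I : ModelWithCorners ℝ E H}
  {M : Type*} [TopologicalSpace M] [ChartedSpace H M]
  {E' : Type*} [NormedAddCommGroup E'] [NormedSpace ℝ E']
  {H' : Type*} [TopologicalSpace H'] {I' : ModelWithCorners ℝ E' H'}
  {P : Type*} [TopologicalSpace P] [ChartedSpace H' P]
  {π : P → M}

lemma dirDeriv_comp_of_related {X : VField I' P} {U : VField I M} {f : M → ℝ} {p : P}
    (hf : MDifferentiableAt I 𝓘(ℝ, ℝ) f (π p)) (hπ : MDifferentiableAt I' I π p)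
    (hXU : mfderiv I' I π p (X p) = U (π p)) :
    dirDeriv X (fun q => f (π q)) p = dirDeriv U f (π p) := by
  rw [dirDeriv, dirDeriv, ← hXU]
  exact congrArg (· (X p)) (mfderiv_comp p hf hπ)

variable [IsManifold I' ∞ P] {α β : OneTensor I' P} {σ : TwoTensor I M}

lemma HasCurvature.dOne_eq (hα : HasCurvature π α σ) {X Y : VField I' P} (hX : SmoothField X)
    (hY : SmoothField Y) (p : P) :
    dOne α X Y p = 2 * Real.pi * σ (π p) (mfderiv I' I π p (X p)) (mfderiv I' I π p (Y p)) := by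
  rw [← hα X Y hX hY p]
  field_simp

lemma HasCurvature.apply_mlieBracket (hα : HasCurvature π α σ) {X Y : VField I' P}
    (hX : SmoothField X) (hY : SmoothField Y) (p : P) :
    α p (VectorField.mlieBracket I' X Y p)
      = dirDeriv X (fun q => α q (Y q)) p - dirDeriv Y (fun q => α q (X q)) p
        - 2 * Real.pi * σ (π p) (mfderiv I' I π p (X p)) (mfderiv I' I π p (Y p)) := by
  rw [← hα.dOne_eq hX hY, dOne]
  ring

namespace IsSplitting

variable [FiniteDimensional ℝ E'] (h : IsSplitting I π α β) {U V : VField I M} {a b c d : M → ℝ}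

lemma dirDeriv_lift {f : M → ℝ} {p : P} (hf : MDifferentiableAt I 𝓘(ℝ, ℝ) f (π p)) :
    dirDeriv (h.lift U a b) (fun q => f (π q)) p = dirDeriv U f (π p) :=
  dirDeriv_comp_of_related hf (h.smooth_proj.mdifferentiable (by simp) p) (h.mfderiv_lift p U a b)

variable [IsManifold I ∞ M] [I.Boundaryless] [CompleteSpace E] [I'.Boundaryless]
  {σ₁ σ₂ : TwoTensor I M}

lemma mlieBracket_lift (h₁ : HasCurvature π α σ₁) (h₂ : HasCurvature π β σ₂)
    (hU : SmoothField U) (ha : ContMDiff I 𝓘(ℝ, ℝ) ∞ a) (hb : ContMDiff I 𝓘(ℝ, ℝ) ∞ b)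
    (hV : SmoothField V) (hc : ContMDiff I 𝓘(ℝ, ℝ) ∞ c) (hd : ContMDiff I 𝓘(ℝ, ℝ) ∞ d) (p : P) :
    VectorField.mlieBracket I' (h.lift U a b) (h.lift V c d) p
      = h.lift (VectorField.mlieBracket I U V)
          (fun x => dirDeriv U c x - dirDeriv V a x - 2 * Real.pi * σ₁ x (U x) (V x))
          (fun x => dirDeriv U d x - dirDeriv V b x - 2 * Real.pi * σ₂ x (U x) (V x)) p := by
  have := FiniteDimensional.complete ℝ E'
  have hX := h.smoothField_lift hU ha hb
  have hY := h.smoothField_lift hV hc hd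
  refine h.ext_of_coords ?_ ?_ ?_
  · rw [mfderiv_lift]
    exact mfderiv_mlieBracket_of_related h.smooth_proj hX hY hU hV (h.mfderiv_lift · U a b)
      (h.mfderiv_lift · V c d) p
  · rw [h₁.apply_mlieBracket hX hY]
    simp only [fst_lift, mfderiv_lift]
    rw [h.dirDeriv_lift (hc.mdifferentiable (by simp) _),
      h.dirDeriv_lift (ha.mdifferentiable (by simp) _)]
  · rw [h₂.apply_mlieBracket hX hY]
    simp only [snd_lift, mfderiv_lift]
    rw [h.dirDeriv_lift (hd.mdifferentiable (by simp) _),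
      h.dirDeriv_lift (hb.mdifferentiable (by simp) _)]

lemma mlieBracket_fstField_lift (h₁ : HasCurvature π α σ₁) (h₂ : HasCurvature π β σ₂)
    (hU : SmoothField U) (s t : ℝ) (p : P) :
    VectorField.mlieBracket I' h.fstField (h.lift U (fun _ => s) (fun _ => t)) p = 0 := by
  have hzero : SmoothField (0 : VField I M) := Bundle.contMDiff_zeroSection ℝ (TangentSpace I)
  refine (h.mlieBracket_lift h₁ h₂ hzero contMDiff_const contMDiff_const hU contMDiff_const
    contMDiff_const p).trans (h.ext_of_coords ?_ ?_ ?_)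
  · rw [mfderiv_lift, map_zero]
    exact congrFun VectorField.mlieBracket_zero_left (π p)
  · simp only [fst_lift, dirDeriv_const, Pi.zero_apply, map_zero, zero_apply, mul_zero, sub_zero]
  · simp only [snd_lift, dirDeriv_const, Pi.zero_apply, map_zero, zero_apply, mul_zero, sub_zero]

end IsSplitting
end Curvature

section Normal

variable {E : Type*} [NormedAddCommGroup E] [NormedSpace ℝ E]
  {H : Type*} [TopologicalSpace H] {I : ModelWithCorners ℝ E H}
  {M : Type*} [TopologicalSpace M] [ChartedSpace H M] [IsManifold I ∞ M]
  {E' : Type*} [NormedAddCommGroup E'] [NormedSpace ℝ E'] [FiniteDimensional ℝ E']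
  {H' : Type*} [TopologicalSpace H'] {I' : ModelWithCorners ℝ E' H'}
  {P : Type*} [TopologicalSpace P] [ChartedSpace H' P] [IsManifold I' ∞ P]
  {π : P → M} {α β : OneTensor I' P} {S : AlmostContactMetric I M}

namespace AlmostContactMetric.Invariant

variable {σ : TwoTensor I M}

lemma apply_ξ_left (hσ : S.Invariant σ) (x : M) (v : TangentSpace I x) : σ x (S.ξ x) v = 0 := by
  rw [← hσ, S.φ_ξ, map_zero, zero_apply]

lemma apply_ξ_right (hσ : S.Invariant σ) (x : M) (v : TangentSpace I x) : σ x v (S.ξ x) = 0 := by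
  rw [← hσ, S.φ_ξ, map_zero]

lemma apply_φ_left (hσ : S.Invariant σ) (x : M) (v w : TangentSpace I x) :
    σ x (S.φ x v) w = -σ x v (S.φ x w) := by
  rw [← hσ x (S.φ x v) w, S.φ_φ_eq, map_add, map_neg, map_smul, add_apply, neg_apply, smul_apply,
    hσ.apply_ξ_left, smul_zero, add_zero]

lemma apply_shiftedφ (hσ : S.Invariant σ) (b d : ℝ) (U V : VField I M) (x : M) :
    σ x (S.shiftedφ b U x) (S.shiftedφ d V x) = σ x (U x) (V x) := by
  simp only [S.shiftedφ_apply, map_add, map_smul, add_apply, smul_apply, hσ.apply_ξ_left,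
    hσ.apply_ξ_right, smul_zero, add_zero, hσ x]

lemma apply_shiftedφ_add (hσ : S.Invariant σ) (b d : ℝ) (U V : VField I M) (x : M) :
    σ x (S.shiftedφ b U x) (V x) + σ x (U x) (S.shiftedφ d V x) = 0 := by
  simp only [S.shiftedφ_apply, map_add, map_smul, add_apply, smul_apply, hσ.apply_ξ_left,
    hσ.apply_ξ_right, smul_zero, add_zero, hσ.apply_φ_left, neg_add_cancel]

end AlmostContactMetric.Invariant

namespace IsSplitting

variable [T2Space P] (h : IsSplitting I π α β) (S)

lemma totalStructure_η (p : P) (v : TangentSpace I' p) : (h.totalStructure S).η p v = α p v :=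
  metric_fstField S p h v

lemma applyφ_lift (U : VField I M) (a : M → ℝ) (b : ℝ) :
    (h.totalStructure S).applyφ (h.lift U a (fun _ => b))
      = h.lift (S.shiftedφ b U) (fun _ => 0) (fun x => -S.η x (U x)) :=
  funext fun p => h.endo_lift S p U a b

variable {S} [FiniteDimensional ℝ E] [I.Boundaryless] [I'.Boundaryless]
  {σ₁ σ₂ : TwoTensor I M}

lemma sasakiHatakeyama_lift (h₁ : HasCurvature π α σ₁) (h₂ : HasCurvature π β σ₂)
    (hS : S.IsNormal) (hinv₁ : S.Invariant σ₁) (hinv₂ : S.Invariant σ₂) {U V : VField I M}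
    (hU : SmoothField U) (hV : SmoothField V) (a b c d : ℝ) (p : P) :
    (h.totalStructure S).sasakiHatakeyama (h.lift U (fun _ => a) (fun _ => b))
      (h.lift V (fun _ => c) (fun _ => d)) p = 0 := by
  have := FiniteDimensional.complete ℝ E
  have hconst (t : ℝ) : ContMDiff I 𝓘(ℝ, ℝ) ∞ fun _ : M => t := contMDiff_const
  have hηU := (S.smoothOneForm_η.apply hU).neg
  have hηV := (S.smoothOneForm_η.apply hV).neg
  have hU' := S.smoothField_shiftedφ b hU
  have hV' := S.smoothField_shiftedφ d hV
  have hφ (v : TangentSpace I' p) : (h.totalStructure S).φ p v = h.endo S p v := rfl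
  have hη : dOne (h.totalStructure S).η (h.lift U (fun _ => a) (fun _ => b))
      (h.lift V (fun _ => c) (fun _ => d)) p = 2 * Real.pi * σ₁ (π p) (U (π p)) (V (π p)) := by
    rw [show (h.totalStructure S).η = α from funext fun q => ContinuousLinearMap.ext
        (h.totalStructure_η S q), h₁.dOne_eq (h.smoothField_lift hU (hconst a) (hconst b))
        (h.smoothField_lift hV (hconst c) (hconst d)), mfderiv_lift, mfderiv_lift]
  have hξ : (h.totalStructure S).ξ = h.fstField := rfl
  simp only [AlmostContactMetric.sasakiHatakeyama, applyφ_lift, hφ, hη, hξ]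
  rw [h.mlieBracket_lift h₁ h₂ hU' (hconst 0) hηU hV' (hconst 0) hηV,
    h.mlieBracket_lift h₁ h₂ hU (hconst a) (hconst b) hV (hconst c) (hconst d),
    h.mlieBracket_lift h₁ h₂ hU' (hconst 0) hηU hV (hconst c) (hconst d),
    h.mlieBracket_lift h₁ h₂ hU (hconst a) (hconst b) hV' (hconst 0) hηV]
  simp only [dirDeriv_const]
  refine h.ext_of_coords ?_ ?_ ?_
  · simp only [map_add, map_sub, map_smul, map_zero, mfderiv_endo, snd_endo, mfderiv_lift, snd_lift,
      mfderiv_fstField, hS.mlieBracket_shiftedφ hU hV, S.φ_φ_eq, S.φ_ξ, dirDeriv_neg]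
    rw [eq_neg_of_add_eq_zero_right (hinv₂.apply_shiftedφ_add b d U V (π p))]
    module
  · simp only [map_add, map_sub, map_smul, map_zero, fst_endo, fst_lift, fst_fstField,
      hinv₁.apply_shiftedφ, smul_eq_mul]
    ring
  · simp only [map_add, map_sub, map_smul, map_zero, mfderiv_endo, snd_endo, mfderiv_lift, snd_lift,
      snd_fstField, hinv₂.apply_shiftedφ, S.η_φ, S.η_ξ, dirDeriv_neg]
    have hdη := hS.dOne_η_shiftedφ_add hU hV b d (π p)
    simp only [dOne, S.η_shiftedφ, dirDeriv_const] at hdη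
    simp only [smul_eq_mul]
    linarith

variable [T2Space M]

lemma isNormal_totalStructure (h₁ : HasCurvature π α σ₁) (h₂ : HasCurvature π β σ₂)
    (hS : S.IsNormal) (hinv₁ : S.Invariant σ₁) (hinv₂ : S.Invariant σ₂) :
    (h.totalStructure S).IsNormal := by
  intro X Y hX hY p
  obtain ⟨U, a, b, hU, hUX⟩ := h.exists_lift_const_eq (X p)
  obtain ⟨V, c, d, hV, hVY⟩ := h.exists_lift_const_eq (Y p)
  rw [AlmostContactMetric.sasakiHatakeyama_congr _ hX
    (h.smoothField_lift hU contMDiff_const contMDiff_const) hY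
    (h.smoothField_lift hV contMDiff_const contMDiff_const) hUX.symm hVY.symm]
  exact h.sasakiHatakeyama_lift h₁ h₂ hS hinv₁ hinv₂ hU hV a b c d p

lemma isKilling_totalStructure (h₁ : HasCurvature π α σ₁) (h₂ : HasCurvature π β σ₂)
    (S : AlmostContactMetric I M) :
    (h.totalStructure S).IsKilling := by
  have := FiniteDimensional.complete ℝ E
  intro X Y hX hY p
  change (h.totalStructure S).lieDerivMetric X Y p = 0
  obtain ⟨U, a, b, hU, hUX⟩ := h.exists_lift_const_eq (X p)
  obtain ⟨V, c, d, hV, hVY⟩ := h.exists_lift_const_eq (Y p)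
  rw [AlmostContactMetric.lieDerivMetric_congr _ hX
    (h.smoothField_lift hU contMDiff_const contMDiff_const) hY
    (h.smoothField_lift hV contMDiff_const contMDiff_const) hUX.symm hVY.symm]
  have hξ : (h.totalStructure S).ξ = h.fstField := rfl
  have hg : (fun q => (h.totalStructure S).g.inner q (h.lift U (fun _ => a) (fun _ => b) q)
      (h.lift V (fun _ => c) (fun _ => d) q))
        = fun q => (fun x => a * c + b * d + S.g.inner x (U x) (V x)) (π q) := by
    funext q
    refine (metric_apply S q _ _).trans ?_
    simp only [fst_lift, snd_lift, mfderiv_lift]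
  rw [AlmostContactMetric.lieDerivMetric, hξ, hg, h.mlieBracket_fstField_lift h₁ h₂ hU,
    h.mlieBracket_fstField_lift h₁ h₂ hV, map_zero, map_zero, zero_apply, sub_zero, sub_zero]
  exact (h.dirDeriv_lift (mdifferentiableAt_const.add (mdifferentiableAt_metric_apply S.g
    (hU.mdifferentiableAt _) (hV.mdifferentiableAt _)))).trans (map_zero _)

end IsSplitting
end Normal

/-! ### Rotating the two forms -/

section Pullback

variable {E : Type*} [NormedAddCommGroup E] [NormedSpace ℝ E]
  {H : Type*} [TopologicalSpace H] {I : ModelWithCorners ℝ E H}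
  {M : Type*} [TopologicalSpace M] [ChartedSpace H M]
  {E' : Type*} [NormedAddCommGroup E'] [NormedSpace ℝ E']
  {H' : Type*} [TopologicalSpace H'] {I' : ModelWithCorners ℝ E' H'}
  {P : Type*} [TopologicalSpace P] [ChartedSpace H' P]
  {π : P → M}

/-- The pullback `π^* α` of a `1`-form. -/
noncomputable def pullback (π : P → M) (α : OneTensor I M) : OneTensor I' P :=
  fun p => (α (π p)).comp (mfderiv I' I π p)

lemma pullback_apply (π : P → M) (α : OneTensor I M) (p : P) (v : TangentSpace I' p) :
    pullback π α p v = α (π p) (mfderiv I' I π p v) := rfl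

lemma pullback_mfderiv_of_comp_eq {f : P → P} (hπ : MDifferentiable I' I π)
    (hf : MDifferentiable I' I' f) (hπf : π ∘ f = π) (α : OneTensor I M) (p : P)
    (v : TangentSpace I' p) :
    pullback π α (f p) (mfderiv I' I' f p v) = pullback π α p v := by
  have hcomp := congrArg (fun L : TangentSpace I' p →L[ℝ] TangentSpace I (π (f p)) =>
    α (π (f p)) (L v)) (mfderiv_comp p (hπ (f p)) (hf p))
  exact hcomp.symm.trans
    (congrArg (fun k : P → M => α (k p) (mfderiv I' I k p v)) hπf)

variable [IsManifold I ∞ M] [IsManifold I' ∞ P] {α : OneTensor I M}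

lemma SmoothOneForm.pullback [FiniteDimensional ℝ E'] [T2Space P] (hα : SmoothOneForm α)
    (hπ : ContMDiff I' I ∞ π) : SmoothOneForm (pullback (I' := I') π α) :=
  smoothOneForm_of_apply fun _ hX q =>
    (Bundle.contMDiffAt_totalSpace.1 (((hα.comp hπ) q).clm_bundle_apply (F₂ := ℝ)
      (E₂ := Bundle.Trivial M ℝ) (((hπ.contMDiff_tangentMap (m := ∞) (by simp)).comp hX) q))).2

lemma dOne_pullback_of_related [I.Boundaryless] [I'.Boundaryless] [CompleteSpace E]
    [CompleteSpace E'] (hα : SmoothOneForm α) (hπ : ContMDiff I' I ∞ π) {X Y : VField I' P}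
    {U V : VField I M} (hX : SmoothField X) (hY : SmoothField Y) (hU : SmoothField U)
    (hV : SmoothField V) (hXU : ∀ q, mfderiv I' I π q (X q) = U (π q))
    (hYV : ∀ q, mfderiv I' I π q (Y q) = V (π q)) (p : P) :
    dOne (pullback π α) X Y p = dOne α U V (π p) := by
  have hπp := hπ.mdifferentiable (by simp) p
  simp only [dOne, pullback_apply, hXU, hYV,
    mfderiv_mlieBracket_of_related hπ hX hY hU hV hXU hYV p]
  rw [dirDeriv_comp_of_related (f := fun x => α x (V x))
      ((hα.apply hV).mdifferentiable (by simp) _) hπp (hXU p),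
    dirDeriv_comp_of_related (f := fun x => α x (U x))
      ((hα.apply hU).mdifferentiable (by simp) _) hπp (hYV p)]

end Pullback

section LinearCombination

variable {E : Type*} [NormedAddCommGroup E] [NormedSpace ℝ E]
  {H : Type*} [TopologicalSpace H] {I : ModelWithCorners ℝ E H}
  {M : Type*} [TopologicalSpace M] [ChartedSpace H M] [IsManifold I ∞ M]

lemma AlmostContactMetric.Invariant.linearCombination {S : AlmostContactMetric I M}
    {σ τ : TwoTensor I M} (hσ : S.Invariant σ) (hτ : S.Invariant τ) (a b : ℝ) :
    S.Invariant (fun x => a • σ x + b • τ x) := fun x v w => by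
  simp only [add_apply, smul_apply, hσ x, hτ x]

variable {α β : OneTensor I M}

lemma SmoothOneForm.linearCombination (hα : SmoothOneForm α) (hβ : SmoothOneForm β) (a b : ℝ) :
    SmoothOneForm (fun x => a • α x + b • β x) :=
  (ContMDiff.const_smul_section (a := a) hα).add_section (ContMDiff.const_smul_section (a := b) hβ)

lemma dOne_linearCombination (hα : SmoothOneForm α) (hβ : SmoothOneForm β) (a b : ℝ)
    {X Y : VField I M} (hX : SmoothField X) (hY : SmoothField Y) (x : M) :
    dOne (fun x => a • α x + b • β x) X Y x = a * dOne α X Y x + b * dOne β X Y x := by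
  have hderiv (Z : VField I M) {W : VField I M} (hW : SmoothField W) :
      dirDeriv Z (fun y => a * α y (W y) + b * β y (W y)) x
        = a * dirDeriv Z (fun y => α y (W y)) x + b * dirDeriv Z (fun y => β y (W y)) x := by
    have hαW := mdifferentiableAt_oneForm_apply hα (hW.mdifferentiableAt x)
    have hβW := mdifferentiableAt_oneForm_apply hβ (hW.mdifferentiableAt x)
    rw [← dirDeriv_const_mul Z a hαW, ← dirDeriv_const_mul Z b hβW]
    exact dirDeriv_add Z (mdifferentiableAt_const.mul hαW) (mdifferentiableAt_const.mul hβW)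
  simp only [dOne, add_apply, smul_apply, smul_eq_mul, hderiv X hY, hderiv Y hX]
  ring

variable {E₀ : Type*} [NormedAddCommGroup E₀] [NormedSpace ℝ E₀]
  {H₀ : Type*} [TopologicalSpace H₀] {I₀ : ModelWithCorners ℝ E₀ H₀}
  {B : Type*} [TopologicalSpace B] [ChartedSpace H₀ B] {π : M → B} {σ τ : TwoTensor I₀ B}

lemma HasCurvature.linearCombination (hασ : HasCurvature π α σ) (hβτ : HasCurvature π β τ)
    (hα : SmoothOneForm α) (hβ : SmoothOneForm β) (a b : ℝ) :
    HasCurvature π (fun p => a • α p + b • β p) (fun x => a • σ x + b • τ x) := by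
  intro X Y hX hY p
  simp only [add_apply, smul_apply, smul_eq_mul]
  rw [dOne_linearCombination hα hβ a b hX hY, ← hασ X Y hX hY, ← hβτ X Y hX hY]
  ring

end LinearCombination

section Rotation

variable {E : Type*} [NormedAddCommGroup E] [NormedSpace ℝ E]
  {H : Type*} [TopologicalSpace H] {I : ModelWithCorners ℝ E H}
  {M : Type*} [TopologicalSpace M] [ChartedSpace H M]
  {E' : Type*} [NormedAddCommGroup E'] [NormedSpace ℝ E']
  {H' : Type*} [TopologicalSpace H'] {I' : ModelWithCorners ℝ E' H'}
  {P : Type*} [TopologicalSpace P] [ChartedSpace H' P] [IsManifold I' ∞ P]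
  {π : P → M} {α β : OneTensor I' P} {s t : ℝ}

namespace IsSplitting

lemma rotate (h : IsSplitting I π α β) (hst : s ^ 2 + t ^ 2 = 1) :
    IsSplitting I π (fun p => t • α p + s • β p) (fun p => -s • α p + t • β p) where
  smooth_proj := h.smooth_proj
  smooth_fst := h.smooth_fst.linearCombination h.smooth_snd t s
  smooth_snd := h.smooth_fst.linearCombination h.smooth_snd (-s) t
  bijective p := by
    let R : ℝ × ℝ ≃ ℝ × ℝ :=
      { toFun := fun x => (t * x.1 + s * x.2, -s * x.1 + t * x.2)
        invFun := fun x => (t * x.1 - s * x.2, s * x.1 + t * x.2)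
        left_inv := fun x => Prod.ext (by dsimp; linear_combination x.1 * hst)
          (by dsimp; linear_combination x.2 * hst)
        right_inv := fun x => Prod.ext (by dsimp; linear_combination x.1 * hst)
          (by dsimp; linear_combination x.2 * hst) }
    exact ((Equiv.refl (TangentSpace I (π p))).prodCongr R).bijective.comp (h.bijective p)

lemma horizontalLift_spec (h : IsSplitting I π α β) (p : P) (u : TangentSpace I (π p)) :
    mfderiv I' I π p (horizontalLift π α β p u) = u ∧ α p (horizontalLift π α β p u) = 0
      ∧ β p (horizontalLift π α β p u) = 0 := by
  have hex : ∃ w, mfderiv I' I π p w = u ∧ α p w = 0 ∧ β p w = 0 := by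
    obtain ⟨w, hw⟩ := (h.bijective p).2 (u, 0, 0)
    exact ⟨w, congrArg Prod.fst hw, congrArg (·.2.1) hw, congrArg (·.2.2) hw⟩
  rw [horizontalLift, dif_pos hex]
  exact hex.choose_spec

variable [FiniteDimensional ℝ E'] (h : IsSplitting I π α β) {p : P}

lemma fstField_eq {v : TangentSpace I' p} (hproj : mfderiv I' I π p v = 0) (hfst : α p v = 1)
    (hsnd : β p v = 0) : h.fstField p = v :=
  h.ext_of_coords ((h.mfderiv_fstField p).trans hproj.symm) ((h.fst_fstField p).trans hfst.symm)
    ((h.snd_fstField p).trans hsnd.symm)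

lemma sndField_eq {v : TangentSpace I' p} (hproj : mfderiv I' I π p v = 0) (hfst : α p v = 0)
    (hsnd : β p v = 1) : h.sndField p = v :=
  h.ext_of_coords ((h.mfderiv_sndField p).trans hproj.symm) ((h.fst_sndField p).trans hfst.symm)
    ((h.snd_sndField p).trans hsnd.symm)

variable (hst : s ^ 2 + t ^ 2 = 1)

lemma rotate_fstField (p : P) :
    (h.rotate hst).fstField p = t • h.fstField p + s • h.sndField p := by
  refine (h.rotate hst).fstField_eq ?_ ?_ ?_ <;>
    simp only [map_add, map_smul, add_apply, smul_apply, smul_eq_mul, mfderiv_fstField,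
      mfderiv_sndField, fst_fstField, snd_fstField, fst_sndField, snd_sndField, smul_zero, add_zero]
  · linear_combination hst
  · ring

variable [IsManifold I ∞ M]

lemma rotate_endo_apply (S : AlmostContactMetric I M) (p : P) (v : TangentSpace I' p) :
    (h.rotate hst).endo S p v
      = horizontalLift π α β p (S.φ (π p) (mfderiv I' I π p v))
        + (-s * α p v + t * β p v) • horizontalLift π α β p (S.ξ (π p))
        - S.η (π p) (mfderiv I' I π p v) • (-s • h.fstField p + t • h.sndField p) := by
  obtain ⟨hφ, hφ₁, hφ₂⟩ := h.horizontalLift_spec p (S.φ (π p) (mfderiv I' I π p v))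
  obtain ⟨hξ, hξ₁, hξ₂⟩ := h.horizontalLift_spec p (S.ξ (π p))
  refine (h.rotate hst).ext_of_coords ?_ ?_ ?_
  · rw [mfderiv_endo]
    simp only [map_sub, map_add, map_smul, hφ, hξ, mfderiv_fstField, mfderiv_sndField, smul_zero,
      add_zero, sub_zero]
    rfl
  · refine ((h.rotate hst).fst_endo S p v).trans ?_
    simp only [map_sub, map_add, map_smul, add_apply, smul_apply, smul_eq_mul, hφ₁, hφ₂, hξ₁, hξ₂,
      fst_fstField, fst_sndField, snd_fstField, snd_sndField]
    ring
  · refine ((h.rotate hst).snd_endo S p v).trans ?_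
    simp only [map_sub, map_add, map_smul, add_apply, smul_apply, smul_eq_mul, hφ₁, hφ₂, hξ₁, hξ₂,
      fst_fstField, fst_sndField, snd_fstField, snd_sndField]
    linear_combination S.η (π p) (mfderiv I' I π p v) * hst

end IsSplitting
end Rotation

/-! ### Connections on torus bundles -/

section Curvature

variable {E : Type*} [NormedAddCommGroup E] [NormedSpace ℝ E] [FiniteDimensional ℝ E]
  {H : Type*} [TopologicalSpace H] {I : ModelWithCorners ℝ E H} [I.Boundaryless]
  {M : Type*} [TopologicalSpace M] [T2Space M] [ChartedSpace H M] [IsManifold I ∞ M]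
  {E' : Type*} [NormedAddCommGroup E'] [NormedSpace ℝ E'] [FiniteDimensional ℝ E']
  {H' : Type*} [TopologicalSpace H'] {I' : ModelWithCorners ℝ E' H'} [I'.Boundaryless]
  {P : Type*} [TopologicalSpace P] [T2Space P] [ChartedSpace H' P] [IsManifold I' ∞ P]
  {π : P → M} {α β : OneTensor I' P} {σ τ : TwoTensor I M}

lemma HasCurvature.add_pullback (h : IsSplitting I π α β) {ρ : OneTensor I' P}
    (hρ : SmoothOneForm ρ) (hρτ : HasCurvature π ρ τ) {θ : OneTensor I M} (hθ : SmoothOneForm θ)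
    (hστ : ∀ X Y, SmoothField X → SmoothField Y →
      ∀ x, σ x (X x) (Y x) - τ x (X x) (Y x) = dOne θ X Y x) :
    HasCurvature π (fun p => (1 : ℝ) • ρ p + (2 * Real.pi) • pullback π θ p) σ := by
  have := FiniteDimensional.complete ℝ E
  have := FiniteDimensional.complete ℝ E'
  intro X Y hX hY p
  obtain ⟨U, a, b, hU, hUX⟩ := h.exists_lift_const_eq (X p)
  obtain ⟨V, c, d, hV, hVY⟩ := h.exists_lift_const_eq (Y p)
  have hX' := h.smoothField_lift hU (contMDiff_const (c := a)) (contMDiff_const (c := b))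
  have hY' := h.smoothField_lift hV (contMDiff_const (c := c)) (contMDiff_const (c := d))
  have hθ' := hθ.pullback (I' := I') h.smooth_proj
  rw [dOne_linearCombination hρ hθ' _ _ hX hY, hρτ.dOne_eq hX hY,
    dOne_congr hθ' hX hX' hY hY' hUX.symm hVY.symm,
    dOne_pullback_of_related hθ h.smooth_proj hX' hY' hU hV (h.mfderiv_lift · U _ _)
      (h.mfderiv_lift · V _ _), ← hστ U V hU hV, ← hUX, ← hVY, h.mfderiv_lift,
    h.mfderiv_lift]
  field_simp
  ring

end Curvature

section TorusBundle

variable {E : Type*} [NormedAddCommGroup E] [NormedSpace ℝ E]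
  {H : Type*} [TopologicalSpace H] {I : ModelWithCorners ℝ E H}
  {M : Type*} [TopologicalSpace M] [ChartedSpace H M]
  {E' : Type*} [NormedAddCommGroup E'] [NormedSpace ℝ E']
  {H' : Type*} [TopologicalSpace H'] {I' : ModelWithCorners ℝ E' H'}
  {P : Type*} [TopologicalSpace P] [ChartedSpace H' P] [MulAction Torus P]
  {π : P → M}

lemma contMDiff_torusCurve (a b : ℝ) :
    ContMDiff 𝓘(ℝ, ℝ) torusModel ∞
      (fun t : ℝ => ((Circle.exp (a * t), Circle.exp (b * t)) : Torus)) := by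
  have hexp (c : ℝ) : ContMDiff 𝓘(ℝ, ℝ) (𝓡 1) ∞ (fun t : ℝ => Circle.exp (c * t)) :=
    (contMDiff_circleExp (m := ∞)).comp (contDiff_const.mul contDiff_id).contMDiff
  exact (hexp a).prodMk (hexp b)

namespace IsPrincipalTorusBundle

lemma mfderiv_fundamentalField (hπ : IsPrincipalTorusBundle I I' π) (a b : ℝ) (p : P) :
    mfderiv I' I π p (fundamentalField I' a b p) = 0 := by
  let γ : ℝ → P := fun t => ((Circle.exp (a * t), Circle.exp (b * t)) : Torus) • p
  have hγ : ContMDiff 𝓘(ℝ, ℝ) I' ∞ γ :=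
    hπ.smooth_act.comp ((contMDiff_torusCurve a b).prodMk contMDiff_const)
  have hγ₀ : γ 0 = p := by
    simp only [γ, mul_zero, Circle.exp_zero, ← Prod.one_eq_mk, one_smul]
  have hbase : ∀ q, q = p → ∀ v : E',
      (mfderiv I' I π q : E' →L[ℝ] E) v = mfderiv I' I π p v := by
    rintro _ rfl _
    rfl
  have hcomp := congrArg (fun L : ℝ →L[ℝ] E => L 1) (mfderiv_comp (0 : ℝ)
    (hπ.smooth_proj.mdifferentiable (by simp) (γ 0)) (hγ.mdifferentiable (by simp) 0))
  have hconst : π ∘ γ = fun _ => π p := funext fun t => hπ.proj_act _ p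
  rw [hconst, mfderiv_const] at hcomp
  exact (hbase _ hγ₀ _).symm.trans hcomp.symm

lemma contMDiff_smul (hπ : IsPrincipalTorusBundle I I' π) (a : Torus) :
    ContMDiff I' I' ∞ (fun p : P => a • p) :=
  hπ.smooth_act.comp (contMDiff_const.prodMk contMDiff_id)

lemma pullback_smul (hπ : IsPrincipalTorusBundle I I' π) (θ : OneTensor I M) (a : Torus) (p : P)
    (v : TangentSpace I' p) :
    pullback π θ (a • p) (mfderiv I' I' (fun q : P => a • q) p v) = pullback π θ p v :=
  pullback_mfderiv_of_comp_eq (hπ.smooth_proj.mdifferentiable (by simp))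
    ((hπ.contMDiff_smul a).mdifferentiable (by simp)) (funext (hπ.proj_act a)) θ p v

lemma pullback_fundamentalField (hπ : IsPrincipalTorusBundle I I' π) (θ : OneTensor I M)
    (a b : ℝ) (p : P) : pullback π θ p (fundamentalField I' a b p) = 0 := by
  rw [pullback_apply, hπ.mfderiv_fundamentalField, map_zero]

lemma exists_mdifferentiable_trivialization (hπ : IsPrincipalTorusBundle I I' π) (p : P) :
    ∃ e : Bundle.Trivialization Torus π, p ∈ e.source ∧
      e.toOpenPartialHomeomorph.MDifferentiable I' (I.prod torusModel) := by
  obtain ⟨e, he, hsmooth, hsymm, -⟩ := hπ.locally_trivial (π p)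
  exact ⟨e, e.mem_source.2 he, hsmooth.mdifferentiableOn (by simp),
    hsymm.mdifferentiableOn (by simp)⟩

lemma surjective_mfderiv (hπ : IsPrincipalTorusBundle I I' π) (p : P) :
    Function.Surjective (mfderiv I' I π p) := by
  obtain ⟨e, hp, he⟩ := hπ.exists_mdifferentiable_trivialization p
  have hfst : Prod.fst ∘ e =ᶠ[nhds p] π :=
    Filter.eventuallyEq_of_mem (e.open_source.mem_nhds hp) fun _ hq => e.coe_fst hq
  have hcomp := mfderiv_comp p (mdifferentiableAt_fst (I := I) (I' := torusModel) (x := e p))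
    (he.mdifferentiableAt hp)
  rw [mfderiv_fst] at hcomp
  have hsurj : Function.Surjective (mfderiv I' I (Prod.fst ∘ e) p) := by
    rw [hcomp]
    exact Prod.fst_surjective.comp (he.mfderiv_surjective hp)
  intro u
  obtain ⟨v, hv⟩ := hsurj u
  exact ⟨v, (congrArg (fun L : E' →L[ℝ] E => L v) hfst.mfderiv_eq).symm.trans hv⟩

lemma finrank_eq [FiniteDimensional ℝ E] (hπ : IsPrincipalTorusBundle I I' π) (p : P) :
    Module.finrank ℝ E' = Module.finrank ℝ E + 2 := by
  obtain ⟨e, hp, he⟩ := hπ.exists_mdifferentiable_trivialization p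
  let L : E' ≃L[ℝ] E × EuclideanSpace ℝ (Fin 1) × EuclideanSpace ℝ (Fin 1) := he.mfderiv hp
  rw [L.toLinearEquiv.finrank_eq, Module.finrank_prod, Module.finrank_prod,
    finrank_euclideanSpace_fin]

end IsPrincipalTorusBundle

namespace IsConnection

variable [IsManifold I' ∞ P] {ω₁ ω₂ : OneTensor I' P}

lemma add_pullback [IsManifold I ∞ M] [FiniteDimensional ℝ E'] [T2Space P]
    (hω : IsConnection ω₁ ω₂) (hπ : IsPrincipalTorusBundle I I' π) {θ₁ θ₂ : OneTensor I M}
    (hθ₁ : SmoothOneForm θ₁) (hθ₂ : SmoothOneForm θ₂) (c : ℝ) :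
    IsConnection (fun p => (1 : ℝ) • ω₁ p + c • pullback (I' := I') π θ₁ p)
      (fun p => (1 : ℝ) • ω₂ p + c • pullback (I' := I') π θ₂ p) where
  smooth₁ := hω.smooth₁.linearCombination (hθ₁.pullback hπ.smooth_proj) 1 c
  smooth₂ := hω.smooth₂.linearCombination (hθ₂.pullback hπ.smooth_proj) 1 c
  fund₁₁ p := by simpa [fundX₁, hπ.pullback_fundamentalField] using hω.fund₁₁ p
  fund₁₂ p := by simpa [fundX₂, hπ.pullback_fundamentalField] using hω.fund₁₂ p
  fund₂₁ p := by simpa [fundX₁, hπ.pullback_fundamentalField] using hω.fund₂₁ p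
  fund₂₂ p := by simpa [fundX₂, hπ.pullback_fundamentalField] using hω.fund₂₂ p
  invariant₁ a p v := by simp only [add_apply, smul_apply, hω.invariant₁, hπ.pullback_smul]
  invariant₂ a p v := by simp only [add_apply, smul_apply, hω.invariant₂, hπ.pullback_smul]

lemma exists_of_coords (hω : IsConnection ω₁ ω₂) (hπ : IsPrincipalTorusBundle I I' π) (p : P)
    (u : TangentSpace I (π p)) (a b : ℝ) :
    ∃ v : TangentSpace I' p, mfderiv I' I π p v = u ∧ ω₁ p v = a ∧ ω₂ p v = b := by
  have hX₁ : mfderiv I' I π p (fundX₁ I' p) = 0 := hπ.mfderiv_fundamentalField 1 0 p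
  have hX₂ : mfderiv I' I π p (fundX₂ I' p) = 0 := hπ.mfderiv_fundamentalField 0 1 p
  obtain ⟨w, hw⟩ := hπ.surjective_mfderiv p u
  refine ⟨w + (a - ω₁ p w) • fundX₁ I' p + (b - ω₂ p w) • fundX₂ I' p, ?_, ?_, ?_⟩
  · simp only [map_add, map_smul, hX₁, hX₂, smul_zero, add_zero, hw]
  · simp only [map_add, map_smul, hω.fund₁₁, hω.fund₁₂, smul_eq_mul]
    ring
  · simp only [map_add, map_smul, hω.fund₂₁, hω.fund₂₂, smul_eq_mul]
    ring

variable [FiniteDimensional ℝ E] [FiniteDimensional ℝ E']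

lemma isSplitting (hω : IsConnection ω₁ ω₂) (hπ : IsPrincipalTorusBundle I I' π) :
    IsSplitting I π ω₁ ω₂ where
  smooth_proj := hπ.smooth_proj
  smooth_fst := hω.smooth₁
  smooth_snd := hω.smooth₂
  bijective p := by
    have hsurj : Function.Surjective ((mfderiv I' I π p).prod ((ω₁ p).prod (ω₂ p))) := by
      rintro ⟨u, a, b⟩
      obtain ⟨v, hu, ha, hb⟩ := hω.exists_of_coords hπ p u a b
      exact ⟨v, Prod.ext hu (Prod.ext ha hb)⟩
    have hrank : Module.finrank ℝ E' = Module.finrank ℝ (E × ℝ × ℝ) := by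
      rw [hπ.finrank_eq p, Module.finrank_prod, Module.finrank_prod, Module.finrank_self]
    exact ⟨(LinearMap.injective_iff_surjective_of_finrank_eq_finrank (V := E') (V₂ := E × ℝ × ℝ)
      (f := ((mfderiv I' I π p).prod ((ω₁ p).prod (ω₂ p))).toLinearMap) hrank).2 hsurj, hsurj⟩

lemma fstField_isSplitting (hω : IsConnection ω₁ ω₂) (hπ : IsPrincipalTorusBundle I I' π) (p : P) :
    (hω.isSplitting hπ).fstField p = fundX₁ I' p :=
  (hω.isSplitting hπ).fstField_eq (hπ.mfderiv_fundamentalField 1 0 p) (hω.fund₁₁ p) (hω.fund₂₁ p)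

lemma sndField_isSplitting (hω : IsConnection ω₁ ω₂) (hπ : IsPrincipalTorusBundle I I' π) (p : P) :
    (hω.isSplitting hπ).sndField p = fundX₂ I' p :=
  (hω.isSplitting hπ).sndField_eq (hπ.mfderiv_fundamentalField 0 1 p) (hω.fund₁₂ p) (hω.fund₂₂ p)

end IsConnection

lemma HasChernClasses.exists_connection [FiniteDimensional ℝ E] [I.Boundaryless] [T2Space M]
    [IsManifold I ∞ M] [FiniteDimensional ℝ E'] [I'.Boundaryless] [T2Space P] [IsManifold I' ∞ P]
    {σ₁ σ₂ : TwoTensor I M} (hchern : HasChernClasses (I' := I') π σ₁ σ₂)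
    (hπ : IsPrincipalTorusBundle I I' π) :
    ∃ ω₁ ω₂ : OneTensor I' P, IsConnection ω₁ ω₂ ∧ HasCurvature π ω₁ σ₁ ∧ HasCurvature π ω₂ σ₂ := by
  obtain ⟨ω₁, ω₂, τ₁, τ₂, hω, -, -, hωτ₁, hωτ₂, ⟨θ₁, hθ₁, hστ₁⟩, ⟨θ₂, hθ₂, hστ₂⟩⟩ := hchern
  have h := hω.isSplitting hπ
  exact ⟨_, _, hω.add_pullback hπ hθ₁ hθ₂ (2 * Real.pi),
    HasCurvature.add_pullback h hω.smooth₁ hωτ₁ hθ₁ hστ₁,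
    HasCurvature.add_pullback h hω.smooth₂ hωτ₂ hθ₂ hστ₂⟩

end TorusBundle

end TorusBundleST

open TorusBundleST in
theorem mainTheorem10_general
    {E : Type*} [NormedAddCommGroup E] [NormedSpace ℝ E] [FiniteDimensional ℝ E]
    {H : Type*} [TopologicalSpace H] {I : ModelWithCorners ℝ E H} [I.Boundaryless]
    {M : Type*} [TopologicalSpace M] [T2Space M] [ChartedSpace H M] [IsManifold I ∞ M]
    (S : AlmostContactMetric I M) (hS : S.IsNormal) (σ₁ σ₂ : TwoTensor I M)
    (hinv₁ : S.Invariant σ₁) (hinv₂ : S.Invariant σ₂)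
    {E' : Type*} [NormedAddCommGroup E'] [NormedSpace ℝ E'] [FiniteDimensional ℝ E']
    {H' : Type*} [TopologicalSpace H'] {I' : ModelWithCorners ℝ E' H'} [I'.Boundaryless]
    {P : Type*} [TopologicalSpace P] [T2Space P] [ChartedSpace H' P] [IsManifold I' ∞ P]
    [MulAction Torus P] (π : P → M) (hπ : IsPrincipalTorusBundle I I' π)
    (hchern : HasChernClasses (I' := I') π σ₁ σ₂) :
    (∃ ω₁ ω₂ : OneTensor I' P,
      IsConnection ω₁ ω₂ ∧ HasCurvature π ω₁ σ₁ ∧ HasCurvature π ω₂ σ₂) ∧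
    ∀ ω₁ ω₂ : OneTensor I' P,
      IsConnection ω₁ ω₂ → HasCurvature π ω₁ σ₁ → HasCurvature π ω₂ σ₂ →
      ∀ s t : ℝ, s ^ 2 + t ^ 2 = 1 →
        ∃ T : AlmostContactMetric I' P, T.IsST ∧
          (∀ (p : P) (v w : TangentSpace I' p),
            T.g.inner p v w = ω₁ p v * ω₁ p w + ω₂ p v * ω₂ p w
              + S.g.inner (π p) (mfderiv I' I π p v) (mfderiv I' I π p w)) ∧
          (∀ p : P, T.ξ p = t • fundX₁ I' p + s • fundX₂ I' p) ∧
          (∀ p : P, T.η p = t • ω₁ p + s • ω₂ p) ∧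
          (∀ (p : P) (v : TangentSpace I' p),
            T.φ p v =
              horizontalLift π ω₁ ω₂ p (S.φ (π p) (mfderiv I' I π p v))
                + (-s * ω₁ p v + t * ω₂ p v) • horizontalLift π ω₁ ω₂ p (S.ξ (π p))
                - S.η (π p) (mfderiv I' I π p v)
                  • (-s • fundX₁ I' p + t • fundX₂ I' p)) := by
  refine ⟨hchern.exists_connection hπ, fun ω₁ ω₂ hω hωσ₁ hωσ₂ s t hst => ?_⟩
  have h := hω.isSplitting hπ
  have hcurv (a b : ℝ) := hωσ₁.linearCombination hωσ₂ hω.smooth₁ hω.smooth₂ a b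
  have hinv (a b : ℝ) := hinv₁.linearCombination hinv₂ a b
  have hrot := h.rotate hst
  refine ⟨hrot.totalStructure S,
    ⟨hrot.isNormal_totalStructure (hcurv t s) (hcurv (-s) t) hS (hinv t s) (hinv (-s) t),
      hrot.isKilling_totalStructure (hcurv t s) (hcurv (-s) t) S⟩,
    fun p v w => ?_, fun p => ?_, fun p => ContinuousLinearMap.ext (hrot.totalStructure_η S p),
    fun p v => ?_⟩
  · exact (IsSplitting.metric_rotate ω₁ ω₂ hst S p v w).trans (IsSplitting.metric_apply S p v w)
  · rw [← hω.fstField_isSplitting hπ p, ← hω.sndField_isSplitting hπ p]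
    exact h.rotate_fstField hst p
  · rw [← hω.fstField_isSplitting hπ p, ← hω.sndField_isSplitting hπ p]
    exact h.rotate_endo_apply hst S p v

open TorusBundleST in
theorem mainTheorem10 {n : ℕ}
    {M : Type*} [TopologicalSpace M] [T2Space M] [SecondCountableTopology M]
    [ChartedSpace (EuclideanSpace ℝ (Fin n)) M] [IsManifold (𝓡 n) ∞ M]
    (S : AlmostContactMetric (𝓡 n) M) (hS : S.IsNormal)
    (σ₁ σ₂ : TwoTensor (𝓡 n) M)
    (hσ₁ : SmoothTwoForm σ₁) (hσ₂ : SmoothTwoForm σ₂)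
    (hclosed₁ : ClosedTwoForm σ₁) (hclosed₂ : ClosedTwoForm σ₂)
    (hinv₁ : S.Invariant σ₁) (hinv₂ : S.Invariant σ₂)
    {P : Type*} [TopologicalSpace P] [T2Space P] [SecondCountableTopology P]
    [ChartedSpace (EuclideanSpace ℝ (Fin (n + 2))) P] [IsManifold (𝓡 (n + 2)) ∞ P]
    [MulAction Torus P] (π : P → M)
    (hπ : IsPrincipalTorusBundle (𝓡 n) (𝓡 (n + 2)) π)
    (hchern : HasChernClasses (I' := 𝓡 (n + 2)) π σ₁ σ₂) :
    (∃ ω₁ ω₂ : OneTensor (𝓡 (n + 2)) P,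
      IsConnection ω₁ ω₂ ∧ HasCurvature π ω₁ σ₁ ∧ HasCurvature π ω₂ σ₂) ∧
    ∀ ω₁ ω₂ : OneTensor (𝓡 (n + 2)) P,
      IsConnection ω₁ ω₂ → HasCurvature π ω₁ σ₁ → HasCurvature π ω₂ σ₂ →
      ∀ s t : ℝ, s ^ 2 + t ^ 2 = 1 →
        ∃ T : AlmostContactMetric (𝓡 (n + 2)) P, T.IsST ∧
          (∀ (p : P) (v w : TangentSpace (𝓡 (n + 2)) p),
            T.g.inner p v w = ω₁ p v * ω₁ p w + ω₂ p v * ω₂ p w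
              + S.g.inner (π p) (mfderiv (𝓡 (n + 2)) (𝓡 n) π p v)
                  (mfderiv (𝓡 (n + 2)) (𝓡 n) π p w)) ∧
          (∀ p : P, T.ξ p = t • fundX₁ (𝓡 (n + 2)) p + s • fundX₂ (𝓡 (n + 2)) p) ∧
          (∀ p : P, T.η p = t • ω₁ p + s • ω₂ p) ∧
          (∀ (p : P) (v : TangentSpace (𝓡 (n + 2)) p),
            T.φ p v =
              horizontalLift (I := 𝓡 n) π ω₁ ω₂ p
                  (S.φ (π p) (mfderiv (𝓡 (n + 2)) (𝓡 n) π p v))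
                + (-s * ω₁ p v + t * ω₂ p v) • horizontalLift (I := 𝓡 n) π ω₁ ω₂ p (S.ξ (π p))
                - S.η (π p) (mfderiv (𝓡 (n + 2)) (𝓡 n) π p v)
                  • (-s • fundX₁ (𝓡 (n + 2)) p + t • fundX₂ (𝓡 (n + 2)) p)) :=
  mainTheorem10_general S hS σ₁ σ₂ hinv₁ hinv₂ π hπ hchern
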